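/- **Setting.** Let the base state space $\mathcal X$ and the measurement space $\mathcal Z$ be standard Borel spaces with atomless $\sigma$-finite reference measures (e.g. $\mathbb R^d$ with Lebesgue measure). A trajectory at time $k$ is a tuple $X=(t,e,x_{t:e})$ with $0\le t\le e\le k$ and $x_t,\dots,x_e\in\mathcal X$; $\int\cdot\,\mathrm dX$ means summation over $(t,e)$ and integration over $x_t,\dots,x_e$, and $\langle f;g\rangle=\int f(X)g(X)\,\mathrm dX$. Densities of random finite sets are taken with respect to the set integral $\int g(\mathbf X)\,\delta\mathbf X=g(\emptyset)+\sum_{n\ge1}\frac1{n!}\int\!\cdots\!\int g(\{X^1,\dots,X^n\})\,\mathrm dX^1\cdots\mathrm dX^n$, and the probability generating functional (PGFL) of a set density $f$ is $G[h]=\int\big(\prod_{X\in\mathbf X}h(X)\big)f(\mathbf X)\,\delta\mathbf X$ for measurable $0\le h\le1$. **PMBM form.** A (track-oriented) Poisson multi-Bernoulli mixture with measurement index set $\mathcal M$ has the PGFL $$G[h]=e^{\langle\lambda;h-1\rangle}\sum_{a\in\mathcal A}w^a\prod_{i=1}^n\big(1-r^{i,a^i}+r^{i,a^i}\langle f^{i,a^i};h\rangle\big),\qquad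 w^a=\frac{\prod_i w^{i,a^i}}{\sum_{b\in\mathcal A}\prod_i w^{i,b^i}},$$ where $\lambda\ge0$ is an integrable intensity, track $i\in\{1,\dots,n\}$ has $h^i$ hypotheses with weights $w^{i,a}\ge0$ and measurement histories $\mathcal M(i,a)\subseteq\mathcal M$; $0\le r^{i,a}\le1$ whenever $w^{i,a}\ne0$, and $f^{i,a}$ is a probability density whenever moreover $r^{i,a}\neq0$. $\mathcal A$ is the set of all $a=(a^1,\dots,a^n)$ with $1\le a^i\le h^i$ for which the sets $\mathcal M(i,a^i)$ are pairwise disjoint with union $\mathcal M$, and $\sum_{a\in\mathcal A}\prod_i w^{i,a^i}>0$. Measurement indices are pairs $(t,j)$ ($j$-th measurement at time $t$). **Measurement model.** For a trajectory $X=(t,e,x_{t:e})$ put $P^{\rm D}(X)=P^{\rm D}(x_e)$ if $e=k$, $P^{\rm D}(X)=0$ if $e<k$, and $\varphi(z|X)=f(z|x_e)$, where $P^{\rm D}:\mathcal X\to[0,1]$ is the detection probability and $f(z|x)$ the single-target likelihood, a probability density in $z$. Given the set $\mathbf X$ of trajectories, the measurement set is the union of independent sets: a Poisson process with integrable intensity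 $\lambda^{\rm FA}$ and, for each $X\in\mathbf X$, a Bernoulli set that is empty with probability $1-P^{\rm D}(X)$ and is $\{z\}$ with density $P^{\rm D}(X)\varphi(z|X)$. Let $\ell(\mathbf Z|\mathbf X)$ be the corresponding set density (the sum, over all the ways to split $\mathbf Z$ into disjoint parts, one for each of these sets, of the product of their densities). **Theorem.** (a) For every finite set $\mathbf X$ of trajectories, $\ell(\cdot|\mathbf X)$ is a set density with PGFL $G_k[g|\mathbf X]=e^{\langle\lambda^{\rm FA};g-1\rangle}\prod_{X\in\mathbf X}\big(1-P^{\rm D}(X)+P^{\rm D}(X)\langle\varphi(\cdot|X);g\rangle\big)$. (b) Suppose that the predicted set density $f_{k|k-1}$ has a PGFL of the PMBM form with parameters $\lambda,n,h^i,\mathcal M^{k-1},\mathcal M^{k-1}(i,a),w^{i,a},r^{i,a},f^{i,a}$, with all measurement indices at times $<k$. Let $\mathbf Z_k=\{z^1,\dots,z^m\}$ consist of $m\ge0$ distinct measurements, such that $\varphi(z^j|\cdot)P^{\rm D}\lambda$ and (whenever $w^{i,a}\ne0\ne r^{i,a}$) $\varphi(z^j|\cdot)P^{\rm D}f^{i,a}$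 are integrable and $\int\ell(\mathbf Z_k|\mathbf X)f_{k|k-1}(\mathbf X)\,\delta\mathbf X>0$. Then the posterior $$f_{k|k}(\mathbf X)=\frac{\ell(\mathbf Z_k|\mathbf X)f_{k|k-1}(\mathbf X)}{\int\ell(\mathbf Z_k|\mathbf X')f_{k|k-1}(\mathbf X')\,\delta\mathbf X'}$$ is a set density whose PGFL is again of the PMBM form (with measurement indices at times $\le k$), with the following parameters, marked by $+$. (Formulas are only relevant where they are needed: parameters of a hypothesis of weight $0$, and the state density of one with existence probability $0$, play no role, and $0/0$ may be read as $0$.) * $n_+=n+m$, $\lambda_+(X)=(1-P^{\rm D}(X))\lambda(X)$, $\mathcal M^k=\mathcal M^{k-1}\cup\{(k,j):1\le j\le m\}$. * For $1\le i\le n$: $h^i_+=h^i(1+m)$. Missed detection, $1\le a\le h^i$: $\mathcal M^k(i,a)=\mathcal M^{k-1}(i,a)$, $$w_+^{i,a}=w^{i,a}\big(1-r^{i,a}\langle f^{i,a};P^{\rm D}\rangle\big),\quad r_+^{i,a}=\frac{r^{i,a}\langle f^{i,a};1-P^{\rm D}\rangle}{1-r^{i,a}\langle f^{i,a};P^{\rm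 D}\rangle},\quad f_+^{i,a}=\frac{(1-P^{\rm D})f^{i,a}}{\langle f^{i,a};1-P^{\rm D}\rangle}.$$ Hypothesis $\tilde a\in\{1,\dots,h^i\}$ updated with $z^j$, numbered $a=\tilde a+h^ij$, $1\le j\le m$: $\mathcal M^k(i,a)=\mathcal M^{k-1}(i,\tilde a)\cup\{(k,j)\}$, $r_+^{i,a}=1$, $$w_+^{i,a}=w^{i,\tilde a}r^{i,\tilde a}\langle f^{i,\tilde a};\varphi(z^j|\cdot)P^{\rm D}\rangle,\quad f_+^{i,a}=\frac{\varphi(z^j|\cdot)P^{\rm D}f^{i,\tilde a}}{\langle f^{i,\tilde a};\varphi(z^j|\cdot)P^{\rm D}\rangle}.$$ * New track $i=n+j$, $1\le j\le m$: $h_+^i=2$; $\mathcal M^k(i,1)=\emptyset$, $w_+^{i,1}=1$, $r_+^{i,1}=0$; $\mathcal M^k(i,2)=\{(k,j)\}$ and, with $c_j=\langle\lambda;\varphi(z^j|\cdot)P^{\rm D}\rangle$, $$w_+^{i,2}=\lambda^{\rm FA}(z^j)+c_j,\quad r_+^{i,2}=\frac{c_j}{\lambda^{\rm FA}(z^j)+c_j},\quad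 f_+^{i,2}=\frac{\varphi(z^j|\cdot)P^{\rm D}\lambda}{c_j}.$$ -/

import Mathlib

open MeasureTheory Finset

/-- The trajectory state space at time `k`: a trajectory is a birth time `t`, a time `e` of the most
recent state, with `t ≤ e ≤ k`, and a sequence of `e - t + 1` states. It is the disjoint union of the
sets `{t} × {e} × X ^ (e - t + 1)`. -/
abbrev Traj (X : Type*) (k : ℕ) : Type _ :=
  Σ p : {p : ℕ × ℕ // p.1 ≤ p.2 ∧ p.2 ≤ k}, (Fin (p.1.2 - p.1.1 + 1) → X)

/-- The time of the most recent state of a trajectory. -/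
def Traj.endTime {X : Type*} {k : ℕ} (x : Traj X k) : ℕ := x.1.1.2

/-- The most recent state of a trajectory. -/
def Traj.lastState {X : Type*} {k : ℕ} (x : Traj X k) : X := x.2 (Fin.last _)

/-- The reference measure on trajectories: integrating against it means summing over the birth time
and the end time, and integrating over all the states in between. -/
noncomputable def trajMeasure {X : Type*} [MeasurableSpace X] (μ : Measure X) (k : ℕ) :
    Measure (Traj X k) :=
  Measure.sum fun p : {p : ℕ × ℕ // p.1 ≤ p.2 ∧ p.2 ≤ k} =>
    (Measure.pi fun _ : Fin (p.1.2 - p.1.1 + 1) => μ).map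
      (Sigma.mk (β := fun q : {q : ℕ × ℕ // q.1 ≤ q.2 ∧ q.2 ≤ k} =>
        Fin (q.1.2 - q.1.1 + 1) → X) p)

section Sets

variable {Y : Type*} [MeasurableSpace Y]

open Classical in
/-- The function `(y₁, …, yₙ) ↦ g {y₁, …, yₙ}` of a function `g` of finite sets. -/
noncomputable def onTuples (g : Finset Y → ℝ) (n : ℕ) (y : Fin n → Y) : ℝ :=
  g (Finset.univ.image y)

/-- The set integral `g ∅ + ∑ₙ (1 / n!) ∫ ⋯ ∫ g {y₁, …, yₙ} dy₁ ⋯ dyₙ`. -/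
noncomputable def setIntegral (m : Measure Y) (g : Finset Y → ℝ) : ℝ :=
  ∑' n : ℕ, (1 / (n.factorial : ℝ)) * ∫ y, onTuples g n y ∂(Measure.pi fun _ : Fin n => m)

/-- `g` is the density of a random finite set: it is nonnegative, and its set integral converges
and equals `1`. -/
structure IsSetDensity (m : Measure Y) (g : Finset Y → ℝ) : Prop where
  nonneg : ∀ W, 0 ≤ g W
  integrable : ∀ n : ℕ, Integrable (onTuples g n) (Measure.pi fun _ : Fin n => m)
  hasSum : HasSum (fun n : ℕ => (1 / (n.factorial : ℝ)) *
    ∫ y, onTuples g n y ∂(Measure.pi fun _ : Fin n => m)) 1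

/-- Test functions of probability generating functionals. -/
structure IsTestFunction (h : Y → ℝ) : Prop where
  measurable : Measurable h
  nonneg : ∀ y, 0 ≤ h y
  le_one : ∀ y, h y ≤ 1

/-- The probability generating functional of the random finite set with density `g`. -/
noncomputable def pgfl (m : Measure Y) (g : Finset Y → ℝ) (h : Y → ℝ) : ℝ :=
  setIntegral m fun W => (∏ y ∈ W, h y) * g W

/-- The pairing `⟨f ; g⟩ = ∫ f g`. -/
noncomputable def pair (m : Measure Y) (f g : Y → ℝ) : ℝ := ∫ y, f y * g y ∂m

/-- The set density of a Poisson point process with intensity `lam`. -/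
noncomputable def pppDensity (m : Measure Y) (lam : Y → ℝ) (W : Finset Y) : ℝ :=
  Real.exp (-∫ y, lam y ∂m) * ∏ y ∈ W, lam y

end Sets

open Classical in
/-- The set density of the union of independent random finite sets with set densities `g i`: the sum,
over all the ways to split `W` into disjoint (possibly empty) parts `W i`, of `∏ i, g i (W i)`.
A splitting is encoded by the map `θ` that sends every element of `W` to the index of its part. -/
noncomputable def unionDensity {Y ι : Type*} [Fintype ι] (g : ι → Finset Y → ℝ)
    (W : Finset Y) : ℝ :=
  ∑ θ : (↥W → ι), ∏ i : ι,
    g i ((Finset.univ.filter fun y : ↥W => θ y = i).map (Function.Embedding.subtype _))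

/-- The ingredients of the standard point-target measurement model, for targets with states in `X`
and measurements in `Z`: the probability of detection, the single-target measurement likelihood
`lik z x` (density of the measurement `z` given the state `x`), and the clutter intensity. -/
structure SensorModel (X Z : Type*) [MeasurableSpace X] [MeasurableSpace Z] (ν : Measure Z) where
  pd : X → ℝ
  pd_measurable : Measurable pd
  pd_nonneg : ∀ x, 0 ≤ pd x
  pd_le_one : ∀ x, pd x ≤ 1
  lik : Z → X → ℝ
  lik_measurable : Measurable (Function.uncurry lik)
  lik_nonneg : ∀ z x, 0 ≤ lik z x
  lik_integral : ∀ x, ∫ z, lik z x ∂ν = 1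
  clutter : Z → ℝ
  clutter_measurable : Measurable clutter
  clutter_nonneg : ∀ z, 0 ≤ clutter z
  clutter_integrable : Integrable clutter ν

namespace SensorModel

variable {X Z : Type*} [MeasurableSpace X] [MeasurableSpace Z] {ν : Measure Z}
  (S : SensorModel X Z ν) {k : ℕ}

/-- The probability of detection of a trajectory at time `k`: that of its last state if the
trajectory is still ongoing at time `k`, and zero otherwise. -/
noncomputable def trajPD (x : Traj X k) : ℝ :=
  if x.endTime = k then S.pd x.lastState else 0

/-- The measurement likelihood of a trajectory: that of its last state. -/
def trajLik (z : Z) (x : Traj X k) : ℝ := S.lik z x.lastState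

open Classical in
/-- The Bernoulli set density of the measurements generated by one trajectory. -/
noncomputable def detectionDensity (x : Traj X k) (W : Finset Z) : ℝ :=
  if W = ∅ then 1 - S.trajPD x
  else if W.card = 1 then ∑ z ∈ W, S.trajPD x * S.trajLik z x
  else 0

/-- The set density of the measurement set `W` given the set `A` of trajectories: `W` is the union of
Poisson clutter (index `none`) and of the Bernoulli measurement sets of the trajectories in `A`, all
of them independent. -/
noncomputable def likelihood (W : Finset Z) (A : Finset (Traj X k)) : ℝ :=
  unionDensity (ι := Option ↥A)
    (fun o => o.elim (pppDensity ν S.clutter) (fun x => S.detectionDensity x.1)) W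

end SensorModel

/-- The parameters of a track-oriented Poisson multi-Bernoulli mixture on `T`. Tracks are numbered
`1, …, n`, and the hypotheses of the track `i` are numbered `1, …, h i`; values outside of these
ranges are irrelevant. A measurement is identified by a pair `(t, j)`: the `j`-th measurement at
time `t`. -/
structure PMBM (T : Type*) where
  /-- the intensity of the Poisson part -/
  lam : T → ℝ
  /-- the number of tracks -/
  n : ℕ
  /-- the number of single-trajectory hypotheses of each track -/
  h : ℕ → ℕ
  /-- the set of all measurement indices so far -/
  allMeas : Finset (ℕ × ℕ)
  /-- the measurements that belong to the hypothesis `a` of the track `i` -/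
  meas : ℕ → ℕ → Finset (ℕ × ℕ)
  /-- hypothesis weights -/
  w : ℕ → ℕ → ℝ
  /-- probabilities of existence -/
  r : ℕ → ℕ → ℝ
  /-- state densities -/
  f : ℕ → ℕ → T → ℝ

namespace PMBM

variable {T : Type*} (P : PMBM T)

open Classical in
/-- The global hypotheses: a choice of one hypothesis for each track, such that every measurement so
far belongs to exactly one of the chosen hypotheses. -/
noncomputable def globalHyps : Finset (↥(Finset.Icc 1 P.n) → ℕ) :=
  (Fintype.piFinset fun i : ↥(Finset.Icc 1 P.n) => Finset.Icc 1 (P.h i)).filter fun a =>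
    (∀ i j : ↥(Finset.Icc 1 P.n), i ≠ j → Disjoint (P.meas i (a i)) (P.meas j (a j))) ∧
      (Finset.univ.biUnion fun i : ↥(Finset.Icc 1 P.n) => P.meas i (a i)) = P.allMeas

/-- The unnormalized weight of a global hypothesis. -/
noncomputable def rawWeight (a : ↥(Finset.Icc 1 P.n) → ℕ) : ℝ :=
  ∏ i : ↥(Finset.Icc 1 P.n), P.w i (a i)

/-- The weight of a global hypothesis, normalized to have sum one. -/
noncomputable def weight (a : ↥(Finset.Icc 1 P.n) → ℕ) : ℝ :=
  P.rawWeight a / ∑ b ∈ P.globalHyps, P.rawWeight b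

variable [MeasurableSpace T]

/-- The PMBM functional: that of a Poisson point process times a mixture of multi-Bernoullis. -/
noncomputable def genFun (m : Measure T) (h : T → ℝ) : ℝ :=
  Real.exp (pair m P.lam fun x => h x - 1) *
    ∑ a ∈ P.globalHyps, P.weight a *
      ∏ i : ↥(Finset.Icc 1 P.n), (1 - P.r i (a i) + P.r i (a i) * pair m (P.f i (a i)) h)

/-- The parameters are admissible, with all the measurements taken before time `t`. A hypothesis of
weight zero does not occur, and a Bernoulli component with probability of existence zero has no
state, so nothing is asked of the parameters that are not defined in these cases. -/
structure WellFormed (m : Measure T) (t : ℕ) : Prop where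
  lam_measurable : Measurable P.lam
  lam_nonneg : ∀ x, 0 ≤ P.lam x
  lam_integrable : Integrable P.lam m
  allMeas_lt : ∀ q ∈ P.allMeas, q.1 < t
  meas_subset : ∀ i ∈ Finset.Icc 1 P.n, ∀ a ∈ Finset.Icc 1 (P.h i), P.meas i a ⊆ P.allMeas
  w_nonneg : ∀ i ∈ Finset.Icc 1 P.n, ∀ a ∈ Finset.Icc 1 (P.h i), 0 ≤ P.w i a
  total_pos : 0 < ∑ a ∈ P.globalHyps, P.rawWeight a
  r_mem : ∀ i ∈ Finset.Icc 1 P.n, ∀ a ∈ Finset.Icc 1 (P.h i), P.w i a ≠ 0 →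
    0 ≤ P.r i a ∧ P.r i a ≤ 1
  f_density : ∀ i ∈ Finset.Icc 1 P.n, ∀ a ∈ Finset.Icc 1 (P.h i), P.w i a ≠ 0 → P.r i a ≠ 0 →
    Measurable (P.f i a) ∧ (∀ x, 0 ≤ P.f i a x) ∧ Integrable (P.f i a) m ∧
      ∫ x, P.f i a x ∂m = 1

/-- `g` is the density of a random finite set whose probability generating functional is of the PMBM
form with the parameters `P`, where all the measurements were taken before time `t`. -/
structure IsDistribution (m : Measure T) (t : ℕ) (g : Finset T → ℝ) : Prop where
  wellFormed : P.WellFormed m t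
  isSetDensity : IsSetDensity m g
  pgfl_eq : ∀ h : T → ℝ, IsTestFunction h → pgfl m g h = P.genFun m h

end PMBM

section Update

variable {X Z : Type*} [MeasurableSpace X] [MeasurableSpace Z]

/-- Bayes' rule: the density of the set of trajectories given the measurement set `W`, when the
predicted density is `g`. -/
noncomputable def posterior (μ : Measure X) {ν : Measure Z} (S : SensorModel X Z ν) {k : ℕ}
    (g : Finset (Traj X k) → ℝ) (W : Finset Z) (A : Finset (Traj X k)) : ℝ :=
  S.likelihood W A * g A /
    setIntegral (trajMeasure μ k) fun B => S.likelihood W B * g B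

/-- `Q` are the parameters of the update of `P` by the measurements `z 0, …, z (m - 1)` of time `k`,
which are numbered `1, …, m`. -/
structure IsUpdate (μ : Measure X) {ν : Measure Z} (S : SensorModel X Z ν) {k m : ℕ}
    (z : Fin m → Z) (P Q : PMBM (Traj X k)) : Prop where
  n_eq : Q.n = P.n + m
  lam_eq : ∀ x, Q.lam x = (1 - S.trajPD x) * P.lam x
  allMeas_eq : Q.allMeas = P.allMeas ∪ Finset.univ.image fun j : Fin m => (k, (j : ℕ) + 1)
  /- tracks that continue -/
  old_h : ∀ i ∈ Finset.Icc 1 P.n, Q.h i = P.h i * (1 + m)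
  /- missed detections -/
  miss_meas : ∀ i ∈ Finset.Icc 1 P.n, ∀ a ∈ Finset.Icc 1 (P.h i), Q.meas i a = P.meas i a
  miss_w : ∀ i ∈ Finset.Icc 1 P.n, ∀ a ∈ Finset.Icc 1 (P.h i),
    Q.w i a = P.w i a * (1 - P.r i a * pair (trajMeasure μ k) (P.f i a) S.trajPD)
  miss_r : ∀ i ∈ Finset.Icc 1 P.n, ∀ a ∈ Finset.Icc 1 (P.h i),
    Q.r i a = P.r i a * pair (trajMeasure μ k) (P.f i a) (fun x => 1 - S.trajPD x) /
      (1 - P.r i a * pair (trajMeasure μ k) (P.f i a) S.trajPD)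
  miss_f : ∀ i ∈ Finset.Icc 1 P.n, ∀ a ∈ Finset.Icc 1 (P.h i), ∀ x,
    Q.f i a x = (1 - S.trajPD x) * P.f i a x /
      pair (trajMeasure μ k) (P.f i a) (fun x => 1 - S.trajPD x)
  /- the hypothesis `a` updated with the measurement `z j` -/
  det_meas : ∀ i ∈ Finset.Icc 1 P.n, ∀ a ∈ Finset.Icc 1 (P.h i), ∀ j : Fin m,
    Q.meas i (a + P.h i * ((j : ℕ) + 1)) = P.meas i a ∪ {(k, (j : ℕ) + 1)}
  det_w : ∀ i ∈ Finset.Icc 1 P.n, ∀ a ∈ Finset.Icc 1 (P.h i), ∀ j : Fin m,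
    Q.w i (a + P.h i * ((j : ℕ) + 1)) = P.w i a * P.r i a *
      pair (trajMeasure μ k) (P.f i a) (fun x => S.trajLik (z j) x * S.trajPD x)
  det_r : ∀ i ∈ Finset.Icc 1 P.n, ∀ a ∈ Finset.Icc 1 (P.h i), ∀ j : Fin m,
    Q.r i (a + P.h i * ((j : ℕ) + 1)) = 1
  det_f : ∀ i ∈ Finset.Icc 1 P.n, ∀ a ∈ Finset.Icc 1 (P.h i), ∀ j : Fin m, ∀ x,
    Q.f i (a + P.h i * ((j : ℕ) + 1)) x =
      S.trajLik (z j) x * S.trajPD x * P.f i a x /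
        pair (trajMeasure μ k) (P.f i a) (fun x => S.trajLik (z j) x * S.trajPD x)
  /- the new track that starts with the measurement `z j` -/
  new_h : ∀ j : Fin m, Q.h (P.n + ((j : ℕ) + 1)) = 2
  new_meas_one : ∀ j : Fin m, Q.meas (P.n + ((j : ℕ) + 1)) 1 = ∅
  new_w_one : ∀ j : Fin m, Q.w (P.n + ((j : ℕ) + 1)) 1 = 1
  new_r_one : ∀ j : Fin m, Q.r (P.n + ((j : ℕ) + 1)) 1 = 0
  new_meas_two : ∀ j : Fin m, Q.meas (P.n + ((j : ℕ) + 1)) 2 = {(k, (j : ℕ) + 1)}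
  new_w_two : ∀ j : Fin m, Q.w (P.n + ((j : ℕ) + 1)) 2 = S.clutter (z j) +
    pair (trajMeasure μ k) P.lam (fun x => S.trajLik (z j) x * S.trajPD x)
  new_r_two : ∀ j : Fin m, Q.r (P.n + ((j : ℕ) + 1)) 2 =
    pair (trajMeasure μ k) P.lam (fun x => S.trajLik (z j) x * S.trajPD x) /
      (S.clutter (z j) +
        pair (trajMeasure μ k) P.lam (fun x => S.trajLik (z j) x * S.trajPD x))
  new_f_two : ∀ j : Fin m, ∀ x, Q.f (P.n + ((j : ℕ) + 1)) 2 x =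
    S.trajLik (z j) x * S.trajPD x * P.lam x /
      pair (trajMeasure μ k) P.lam (fun x => S.trajLik (z j) x * S.trajPD x)

end Update

/-!
The generating functional of a random finite set determines every integral of its density against a
product of test functions, and Bayes' rule only asks for one particular coefficient of it. On a set
of distinct points, the likelihood of `m` measurements `z j` given targets `y i` is, up to the factor
`exp (-∫ clutter)`, a sum over the partial matchings of targets with measurements
(`SensorModel.likelihood_image_image`). Such a sum, `matchingSum`, is the coefficient of `∏ j, s j` in
`∏ j, (1 + s j * l j) * ∏ i, (v (y i) + ∑ j, s j * u j (y i))`, where `l` is the clutter intensity,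
`v` the probability of a missed detection and `u j` the density of detecting a target as `z j`.

This coefficient is extracted by alternating sums over the vertices of the cube `[0, ε]^m`, divided by
`ε^m`, for `ε → 0` (`tendsto_cubeDiff`). All coefficients involved are nonnegative, so that the
alternating sums are monotone in `ε` and dominated convergence lets the limit pass under the set
integral (`integral_matchingSum`). The set integral itself is written as an integral against a single
measure on tuples of all lengths, `tupleMeasure`; the reference measure has no atoms, so that almost
all tuples have distinct points and repetitions in a set of values do not matter.

For the measurement model, where the roles of targets and measurements are exchanged, the set
integrals of products are exponentials (`integral_prod_tupleMeasure`), and extraction yields the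
Bernoulli factors. For the update, the function `v + ∑ j, s j * u j` must be a test function before
the generating functional of the prediction can be applied to it. This holds for small `s` if the
single-target likelihoods are bounded; in general they are truncated, and monotone convergence removes
the truncation (`PMBM.integral_density_matchingSum`).

Applied to the PMBM functional the extraction gives, for each global hypothesis of the prediction, a
sum over the matchings of old tracks with new measurements, where an unmatched measurement
contributes the weight of clutter or of a target seen for the first time. These triples of an old
global hypothesis, a matching, and the set of new tracks in use are the global hypotheses of the
update (`IsUpdate.sum_globalHyps`), and the factors are the weights and Bernoulli functionals of its
hypotheses (`IsUpdate.multilinearCoeff_eq`). Dividing by the value at the constant test function `1`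
normalizes the weights.
-/

section PMBMUpdate

open Filter Topology

/-! ### Measure theory of tuples and of trajectories -/

theorem measurable_sigma_iff {ι B : Type*} {α : ι → Type*} [∀ i, MeasurableSpace (α i)]
    [MeasurableSpace B] {f : (Σ i, α i) → B} :
    Measurable f ↔ ∀ i, Measurable fun a : α i => f ⟨i, a⟩ := by
  constructor
  · intro hf i s hs
    exact MeasurableSpace.measurableSet_iInf.1 (hf hs) i
  · intro hf s hs
    exact MeasurableSpace.measurableSet_iInf.2 fun i => hf i hs

theorem measurable_sigma_mk {ι : Type*} {α : ι → Type*} [∀ i, MeasurableSpace (α i)] (i : ι) :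
    Measurable (Sigma.mk i : α i → Σ i, α i) :=
  measurable_sigma_iff.1 measurable_id i

theorem measurableEmbedding_sigma_mk {ι : Type*} {α : ι → Type*} [∀ i, MeasurableSpace (α i)]
    (i : ι) : MeasurableEmbedding (Sigma.mk i : α i → Σ i, α i) where
  injective := sigma_mk_injective
  measurable := measurable_sigma_mk i
  measurableSet_image' := by
    intro s hs
    refine MeasurableSpace.measurableSet_iInf.2 fun j => ?_
    by_cases hij : i = j
    · subst hij
      change MeasurableSet (Sigma.mk i ⁻¹' (Sigma.mk i '' s))
      rwa [Set.preimage_image_eq _ sigma_mk_injective]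
    · change MeasurableSet (Sigma.mk j ⁻¹' (Sigma.mk i '' s))
      convert MeasurableSet.empty
      ext x
      constructor
      · rintro ⟨y, -, hy⟩
        exact (hij (congrArg Sigma.fst hy)).elim
      · exact fun h => h.elim

theorem MeasurableEq.of_injective {A B : Type*} [MeasurableSpace A] [MeasurableSpace B]
    [MeasurableEq B] {f : A → B} (hf : Measurable f) (hinj : Function.Injective f) :
    MeasurableEq A where
  measurableSet_diagonal := by
    convert measurableSet_eq_fun (hf.comp measurable_fst) (hf.comp measurable_snd)
    ext x
    simp [hinj.eq_iff]

instance {X : Type*} [MeasurableSpace X] [StandardBorelSpace X] : MeasurableEq X := by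
  let := upgradeStandardBorel X
  infer_instance

instance {I X : Type*} [Countable I] [MeasurableSpace X] [MeasurableEq X] :
    MeasurableEq (I → X) where
  measurableSet_diagonal := by
    have : Set.diagonal (I → X) = ⋂ i, {p | p.1 i = p.2 i} := by
      ext p
      simp [funext_iff]
    rw [this]
    exact MeasurableSet.iInter fun i => measurableSet_eq_fun
      ((measurable_pi_apply i).comp measurable_fst) ((measurable_pi_apply i).comp measurable_snd)

instance {A B : Type*} [MeasurableSpace A] [MeasurableSpace B] [MeasurableEq A] [MeasurableEq B] :
    MeasurableEq (A × B) where
  measurableSet_diagonal := by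
    have : Set.diagonal (A × B) = {p | p.1.1 = p.2.1} ∩ {p | p.1.2 = p.2.2} := by
      ext p
      simp [Prod.ext_iff]
    rw [this]
    exact (measurableSet_eq_fun (by fun_prop) (by fun_prop)).inter
      (measurableSet_eq_fun (by fun_prop) (by fun_prop))

section Traj

variable {X : Type*} [MeasurableSpace X] {k : ℕ}

/-- The pairs of a birth time and an end time are finitely many. -/
instance finite_trajTimes (k : ℕ) : Finite {p : ℕ × ℕ // p.1 ≤ p.2 ∧ p.2 ≤ k} :=
  Set.Finite.to_subtype (((Set.finite_Iic k).prod (Set.finite_Iic k)).subset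
    fun _ hp => ⟨hp.1.trans hp.2, hp.2⟩)

theorem measurable_endTime : Measurable (Traj.endTime : Traj X k → ℕ) :=
  measurable_sigma_iff.2 fun _ => by
    simp only [Traj.endTime]
    exact measurable_const

theorem measurable_lastState : Measurable (Traj.lastState : Traj X k → X) :=
  measurable_sigma_iff.2 fun _ => by
    simp only [Traj.lastState]
    exact measurable_pi_apply _

instance measurableEq_traj [StandardBorelSpace X] : MeasurableEq (Traj X k) := by
  rcases isEmpty_or_nonempty X with hX | ⟨⟨x₀⟩⟩
  · have : IsEmpty (Traj X k) := ⟨fun x => hX.false x.lastState⟩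
    infer_instance
  · -- a trajectory is determined by its times and its states, padded to an infinite sequence
    refine MeasurableEq.of_injective
      (f := fun x : Traj X k => (x.1.1, fun n : ℕ =>
        if h : n < x.1.1.2 - x.1.1.1 + 1 then x.2 ⟨n, h⟩ else x₀)) ?_ ?_
    · refine measurable_sigma_iff.2 fun p => Measurable.prodMk (by simp)
        (measurable_pi_lambda _ fun n => ?_)
      by_cases h : n < p.1.2 - p.1.1 + 1
      · simp only [h, dif_pos]
        exact (measurable_pi_apply (⟨n, h⟩ : Fin (p.1.2 - p.1.1 + 1)) :
          Measurable fun c : Fin (p.1.2 - p.1.1 + 1) → X => c ⟨n, h⟩)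
      · simp [h]
    · rintro ⟨p, x⟩ ⟨q, y⟩ h
      simp only [Prod.mk.injEq] at h
      obtain ⟨h1, h2⟩ := h
      have h3 : p = q := Subtype.ext h1
      subst h3
      congr 1
      funext i
      simpa [Nat.lt_succ_iff.1 i.2] using congrFun h2 i.1

instance sigmaFinite_trajMeasure (μ : Measure X) [SigmaFinite μ] :
    SigmaFinite (trajMeasure μ k) := by
  have h : ∀ p : {p : ℕ × ℕ // p.1 ≤ p.2 ∧ p.2 ≤ k}, SigmaFinite
      ((Measure.pi fun _ : Fin (p.1.2 - p.1.1 + 1) => μ).map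
      (Sigma.mk (β := fun q : {q : ℕ × ℕ // q.1 ≤ q.2 ∧ q.2 ≤ k} =>
        Fin (q.1.2 - q.1.1 + 1) → X) p)) :=
    fun p => (measurableEmbedding_sigma_mk p).sigmaFinite_map
  unfold trajMeasure
  infer_instance

instance nullSingletonClass_trajMeasure [MeasurableSingletonClass X] (μ : Measure X) [SigmaFinite μ]
    [NullSingletonClass μ] : NullSingletonClass (trajMeasure μ k) where
  measure_singleton x := by
    have hx : MeasurableSet ({x} : Set (Traj X k)) := by
      have := (measurableEmbedding_sigma_mk (α := fun q : {q : ℕ × ℕ // q.1 ≤ q.2 ∧ q.2 ≤ k} =>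
        Fin (q.1.2 - q.1.1 + 1) → X) x.1).measurableSet_image' (MeasurableSet.singleton x.2)
      simpa using this
    rw [trajMeasure, Measure.sum_apply _ hx]
    refine ENNReal.tsum_eq_zero.2 fun p => ?_
    rw [(measurableEmbedding_sigma_mk p).map_apply]
    refine Set.Subsingleton.measure_zero (fun a ha b hb => ?_) _
    exact sigma_mk_injective (ha.trans hb.symm)

end Traj

section Tuples

variable {Y : Type*} [MeasurableSpace Y]

/-- Points of a tuple are almost everywhere distinct, since the reference measure has no atoms. -/
theorem ae_injective_pi [MeasurableEq Y] (m : Measure Y) [SigmaFinite m] [NullSingletonClass m]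
    (n : ℕ) : ∀ᵐ y ∂(Measure.pi fun _ : Fin n => m), Function.Injective y := by
  have key : ∀ i j : Fin n, i ≠ j → ∀ᵐ y ∂(Measure.pi fun _ : Fin n => m), y i ≠ y j := by
    intro i j hij
    obtain _ | n := n
    · exact i.elim0
    obtain ⟨l, rfl⟩ := Fin.exists_succAbove_eq hij.symm
    have hp := measurePreserving_piFinSuccAbove (fun _ : Fin (n + 1) => m) i
    have hs : MeasurableSet {p : Y × (Fin n → Y) | p.1 = p.2 l} :=
      measurableSet_eq_fun measurable_fst ((measurable_pi_apply l).comp measurable_snd)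
    have h0 : (m.prod (Measure.pi fun _ : Fin n => m)) {p : Y × (Fin n → Y) | p.1 = p.2 l} = 0 := by
      rw [Measure.measure_prod_null hs]
      filter_upwards with a
      simpa [eq_comm] using Measure.pi_hyperplane (fun _ : Fin n => m) l a
    have := hp.measure_preimage hs.nullMeasurableSet
    rw [h0] at this
    exact measure_mono_null (fun y hy => by simpa [Fin.removeNth] using hy) this
  have := ae_all_iff.2 fun i => ae_all_iff.2 fun j => ae_all_iff.2 (key i j)
  filter_upwards [this] with y hy i j hij
  by_contra h
  exact hy i j h hij

end Tuples

/-! ### Sums over partial matchings as multilinear coefficients -/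

/-- The factor of a measurement (or target) with base weight `l` that has been chosen `n` times:
`l` if it was not chosen, `1` if it was chosen once, `0` otherwise. -/
def onceFactor (l : ℝ) : ℕ → ℝ
  | 0 => l
  | 1 => 1
  | _ + 2 => 0

theorem onceFactor_nonneg {l : ℝ} (hl : 0 ≤ l) : ∀ n, 0 ≤ onceFactor l n
  | 0 => hl
  | 1 => zero_le_one
  | _ + 2 => le_rfl

open Classical in
/-- The sum over all partial matchings of `I` with `J`, where an unmatched `i` contributes `v i`, an
unmatched `j` contributes `l j`, and a matched pair contributes `u i j`. A matching is encoded as a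
map `I → Option J`; the maps that take a value in `J` twice contribute zero. -/
noncomputable def matchingSum {I J : Type*} [Fintype I] [Fintype J] (v : I → ℝ) (l : J → ℝ)
    (u : I → J → ℝ) : ℝ :=
  ∑ θ : I → Option J, (∏ i, (θ i).elim (v i) (u i)) *
    ∏ j, onceFactor (l j) #{i | θ i = some j}

section Converse

variable {I J : Type*}

open Classical in
/-- The converse of the partial matching `θ`. -/
noncomputable def converseMatching (θ : I → Option J) (j : J) : Option I :=
  if h : ∃ i, θ i = some j then some h.choose else none

theorem converseMatching_eq_some {θ : I → Option J}
    (hθ : ∀ i i' j, θ i = some j → θ i' = some j → i = i') {i : I} {j : J} :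
    converseMatching θ j = some i ↔ θ i = some j := by
  unfold converseMatching
  split_ifs with h
  · rw [Option.some_inj]
    exact ⟨fun h' => h' ▸ h.choose_spec, fun h' => hθ _ _ _ h.choose_spec h'⟩
  · exact ⟨fun h' => by simp at h', fun h' => (h ⟨i, h'⟩).elim⟩

theorem converseMatching_injective {θ : I → Option J}
    (hθ : ∀ i i' j, θ i = some j → θ i' = some j → i = i') (j j' : J) (i : I)
    (h : converseMatching θ j = some i) (h' : converseMatching θ j' = some i) : j = j' := by
  rw [converseMatching_eq_some hθ] at h h'
  exact Option.some_inj.1 (h.symm.trans h')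

theorem converseMatching_converseMatching {θ : I → Option J}
    (hθ : ∀ i i' j, θ i = some j → θ i' = some j → i = i') :
    converseMatching (converseMatching θ) = θ := by
  funext i
  refine Option.ext fun j => ?_
  rw [converseMatching_eq_some (converseMatching_injective hθ), converseMatching_eq_some hθ]

end Converse

section Algebra

variable {I J : Type*} [Fintype I] [Fintype J]

omit [Fintype J] in
theorem elim_nonneg {v : ℝ} {u : J → ℝ} (hv : 0 ≤ v) (hu : ∀ j, 0 ≤ u j) (o : Option J) :
    0 ≤ o.elim v u := by
  cases o
  exacts [hv, hu _]

theorem matchingSum_nonneg {v : I → ℝ} {l : J → ℝ} {u : I → J → ℝ} (hv : ∀ i, 0 ≤ v i)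
    (hl : ∀ j, 0 ≤ l j) (hu : ∀ i j, 0 ≤ u i j) : 0 ≤ matchingSum v l u :=
  sum_nonneg fun _ _ => mul_nonneg (prod_nonneg fun i _ => elim_nonneg (hv i) (hu i) _)
    (prod_nonneg fun j _ => onceFactor_nonneg (hl j) _)

theorem matchingSum_mono {v : I → ℝ} {l : J → ℝ} {u u' : I → J → ℝ} (hv : ∀ i, 0 ≤ v i)
    (hl : ∀ j, 0 ≤ l j) (hu : ∀ i j, 0 ≤ u i j) (huu : ∀ i j, u i j ≤ u' i j) :
    matchingSum v l u ≤ matchingSum v l u' := by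
  refine sum_le_sum fun θ _ => mul_le_mul_of_nonneg_right
    (prod_le_prod (fun i _ => elim_nonneg (hv i) (hu i) _) fun i _ => ?_)
    (prod_nonneg fun j _ => onceFactor_nonneg (hl j) _)
  cases θ i
  exacts [le_rfl, huu _ _]

theorem continuous_onceFactor (n : ℕ) : Continuous fun l => onceFactor l n := by
  match n with
  | 0 => exact continuous_id
  | 1 => exact continuous_const
  | _ + 2 => exact continuous_const

theorem tendsto_matchingSum {α : Type*} {F : Filter α} {v : α → I → ℝ} {v₀ : I → ℝ}
    {l : α → J → ℝ} {l₀ : J → ℝ} {u : α → I → J → ℝ} {u₀ : I → J → ℝ}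
    (hv : ∀ i, Tendsto (fun a => v a i) F (𝓝 (v₀ i)))
    (hl : ∀ j, Tendsto (fun a => l a j) F (𝓝 (l₀ j)))
    (hu : ∀ i j, Tendsto (fun a => u a i j) F (𝓝 (u₀ i j))) :
    Tendsto (fun a => matchingSum (v a) (l a) (u a)) F (𝓝 (matchingSum v₀ l₀ u₀)) := by
  refine tendsto_finsetSum _ fun θ _ => (tendsto_finsetProd _ fun i _ => ?_).mul
    (tendsto_finsetProd _ fun j _ => ((continuous_onceFactor _).tendsto _).comp (hl j))
  cases θ i
  exacts [hv i, hu i _]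

theorem matchingSum_mul_left (c : I → ℝ) (v : I → ℝ) (l : J → ℝ) (u : I → J → ℝ) :
    matchingSum (fun i => c i * v i) l (fun i j => c i * u i j) =
      (∏ i, c i) * matchingSum v l u := by
  rw [matchingSum, matchingSum, mul_sum]
  refine sum_congr rfl fun θ _ => ?_
  rw [← mul_assoc, ← prod_mul_distrib]
  congr 1
  refine prod_congr rfl fun i _ => ?_
  cases θ i <;> rfl

theorem matchingSum_reindex {I' J' : Type*} [Fintype I'] [Fintype J'] (e : I' ≃ I) (e' : J' ≃ J)
    (v : I → ℝ) (l : J → ℝ) (u : I → J → ℝ) :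
    matchingSum (fun i => v (e i)) (fun j => l (e' j)) (fun i j => u (e i) (e' j)) =
      matchingSum v l u := by
  classical
  rw [matchingSum, matchingSum]
  refine Fintype.sum_equiv (Equiv.arrowCongr e (Equiv.optionCongr e')) _ _ fun θ => ?_
  congr 1
  · refine Fintype.prod_equiv e _ _ fun i => ?_
    simp only [Equiv.arrowCongr_apply, Function.comp, Equiv.symm_apply_apply]
    cases θ i <;> rfl
  · refine Fintype.prod_equiv e' _ _ fun j => ?_
    congr 1
    refine card_equiv e fun i => ?_
    simp only [mem_filter, mem_univ, true_and, Equiv.arrowCongr_apply, Function.comp,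
      Equiv.symm_apply_apply]
    cases θ i <;> simp

open Classical in
/-- A map whose values in `J` are taken at most once contributes the product over its unmatched
points of `I` and of `J` and over its matched pairs. -/
theorem matchingSum_eq_sum_filter (v : I → ℝ) (l : J → ℝ) (u : I → J → ℝ) :
    matchingSum v l u = ∑ θ : I → Option J with ∀ i i' j, θ i = some j → θ i' = some j → i = i',
      (∏ i, (θ i).elim (v i) fun _ => 1) *
      (∏ j, if ∃ i, θ i = some j then 1 else l j) *
      ∏ p : I × J, if θ p.1 = some p.2 then u p.1 p.2 else 1 := by
  rw [matchingSum, sum_filter]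
  refine sum_congr rfl fun θ _ => ?_
  split_ifs with h
  · have h1 : ∀ j, onceFactor (l j) #{i | θ i = some j} =
        if ∃ i, θ i = some j then 1 else l j := by
      intro j
      split_ifs with hj
      · obtain ⟨i, hi⟩ := hj
        have : ({i | θ i = some j} : Finset I) = {i} := by
          ext i'
          simp only [mem_filter, mem_univ, true_and, mem_singleton]
          exact ⟨fun h' => h _ _ _ h' hi, fun h' => h' ▸ hi⟩
        rw [this, card_singleton]
        rfl
      · rw [filter_eq_empty_iff.2 fun i _ hi => hj ⟨i, hi⟩, card_empty]
        rfl
    rw [prod_congr rfl fun j _ => h1 j, mul_right_comm, ← univ_product_univ, prod_product,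
      ← prod_mul_distrib]
    congr 1
    refine prod_congr rfl fun i _ => ?_
    rcases hi : θ i with - | j <;> simp [hi]
  · push Not at h
    obtain ⟨i, i', j, hi, hi', hne⟩ := h
    have : 1 < #{i | θ i = some j} := one_lt_card.2 ⟨i, by simpa, i', by simpa, hne⟩
    obtain ⟨c, hc⟩ := Nat.exists_eq_add_of_le' this
    rw [prod_eq_zero (mem_univ j) (by rw [hc]; rfl : onceFactor (l j) _ = 0), mul_zero]

/-- The two sides of a matching play the same role. -/
theorem matchingSum_symm (v : I → ℝ) (l : J → ℝ) (u : I → J → ℝ) :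
    matchingSum v l u = matchingSum l v fun j i => u i j := by
  classical
  rw [matchingSum_eq_sum_filter, matchingSum_eq_sum_filter]
  refine sum_nbij' converseMatching converseMatching ?_ ?_ ?_ ?_ ?_
  · intro θ hθ
    simp only [mem_filter, mem_univ, true_and] at hθ ⊢
    exact converseMatching_injective hθ
  · intro θ hθ
    simp only [mem_filter, mem_univ, true_and] at hθ ⊢
    exact converseMatching_injective hθ
  · intro θ hθ
    simp only [mem_filter, mem_univ, true_and] at hθ
    exact converseMatching_converseMatching hθ
  · intro θ hθ
    simp only [mem_filter, mem_univ, true_and] at hθ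
    exact converseMatching_converseMatching hθ
  · intro θ hθ
    simp only [mem_filter, mem_univ, true_and] at hθ
    rw [mul_comm (∏ i, _)]
    congr 1
    · congr 1
      · refine prod_congr rfl fun j _ => ?_
        simp only [← converseMatching_eq_some hθ]
        cases converseMatching θ j <;> simp
      · refine prod_congr rfl fun i _ => ?_
        simp only [converseMatching_eq_some hθ]
        cases θ i <;> simp
    · refine Fintype.prod_equiv (Equiv.prodComm I J) _ _ fun p => ?_
      simp only [Equiv.prodComm_apply, Prod.fst_swap, Prod.snd_swap, converseMatching_eq_some hθ]

end Algebra

section Extraction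

variable {I J : Type*} [Fintype I] [Fintype J]

open Classical in
/-- The alternating sum over the vertices of the cube `[0, ε]^J`, divided by its volume. As `ε` tends
to zero it extracts from a power series its coefficient of `∏ j, s j`. The vertex with the
coordinates `ε` on `S` and `0` off `S` is encoded by the set `S`. -/
noncomputable def cubeDiff (ε : ℝ) (F : Finset J → ℝ) : ℝ :=
  ∑ S : Finset J, (-1) ^ #Sᶜ * F S / ε ^ Fintype.card J

/-- The contribution of one coordinate to `cubeDiff`: the difference of `g s * s ^ n` between `s = ε` and
`s = 0`, divided by `ε`, where `g` stands for the value of the factor at `ε`, and the factor is `1`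
at zero. -/
noncomputable def coordDiff (ε g : ℝ) (n : ℕ) : ℝ := (g * ε ^ n - 0 ^ n) / ε

theorem cubeDiff_sum {K : Type*} (s : Finset K) (ε : ℝ) (c : K → ℝ) (F : K → Finset J → ℝ) :
    cubeDiff ε (fun S => ∑ a ∈ s, c a * F a S) = ∑ a ∈ s, c a * cubeDiff ε (F a) := by
  simp only [cubeDiff, mul_sum, sum_div]
  rw [sum_comm]
  refine sum_congr rfl fun a _ => sum_congr rfl fun S _ => ?_
  ring

open Classical in
/-- The alternating sum factors over the coordinates. -/
theorem cubeDiff_prod (ε : ℝ) (a b : J → ℝ) :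
    cubeDiff ε (fun S => ∏ j, if j ∈ S then a j else b j) = ∏ j, (a j - b j) / ε := by
  simp only [div_eq_mul_inv, prod_mul_distrib, prod_const, card_univ, sub_eq_add_neg]
  rw [prod_add, sum_mul, powerset_univ, cubeDiff]
  refine sum_congr rfl fun S _ => ?_
  rw [div_eq_mul_inv, inv_pow, prod_ite]
  congr 1
  rw [← compl_eq_univ_sdiff, prod_neg, filter_mem_eq_inter, univ_inter, mul_left_comm]
  congr 3
  ext j; simp

open Classical in
theorem prod_elim_one (θ : I → Option J) (t : J → ℝ) :
    ∏ i, (θ i).elim 1 t = ∏ j, t j ^ #{i | θ i = some j} := by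
  rw [← prod_fiberwise univ θ fun i => (θ i).elim 1 t, Fintype.prod_option]
  rw [prod_eq_one, one_mul]
  · refine prod_congr rfl fun j _ => ?_
    rw [prod_congr rfl (g := fun _ => t j), prod_const]
    intro i hi
    rw [(mem_filter.1 hi).2]
    rfl
  · intro i hi
    rw [(mem_filter.1 hi).2]
    rfl

open Classical in
/-- The expansion of the products at the vertices of the cube over the maps `I → Option J`. -/
theorem cubeDiff_expand (ε : ℝ) (g : J → ℝ) (v : I → ℝ) (u : I → J → ℝ) :
    cubeDiff ε (fun S => (∏ j ∈ S, g j) * ∏ i, (v i + ε * ∑ j ∈ S, u i j)) =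
      ∑ θ : I → Option J, (∏ i, (θ i).elim (v i) (u i)) *
        ∏ j, coordDiff ε (g j) #{i | θ i = some j} := by
  have h1 : ∀ S : Finset J, (∏ j ∈ S, g j) * ∏ i, (v i + ε * ∑ j ∈ S, u i j) =
      ∑ θ : I → Option J, (∏ i, (θ i).elim (v i) (u i)) *
        ∏ j, if j ∈ S then g j * ε ^ #{i | θ i = some j} else 0 ^ #{i | θ i = some j} := by
    intro S
    have h2 : ∀ i, v i + ε * ∑ j ∈ S, u i j = ∑ o : Option J, o.elim (v i) (u i) *
        o.elim 1 (fun j => if j ∈ S then ε else 0) := by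
      intro i
      rw [Fintype.sum_option, mul_sum]
      simp [mul_comm]
    rw [prod_congr rfl fun i _ => h2 i, prod_univ_sum, Fintype.piFinset_univ, mul_sum]
    refine sum_congr rfl fun θ _ => ?_
    rw [prod_mul_distrib, prod_elim_one, mul_left_comm]
    congr 1
    rw [← Fintype.prod_ite_mem S, ← prod_mul_distrib]
    refine prod_congr rfl fun j _ => ?_
    split_ifs <;> simp
  rw [funext h1, cubeDiff_sum]
  refine sum_congr rfl fun θ _ => ?_
  rw [cubeDiff_prod]
  rfl

/-- The limit is the coefficient of `s` in `g s * s ^ n`. -/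
theorem tendsto_coordDiff {g : ℝ → ℝ} {g' : ℝ} (h0 : g 0 = 1) (hg : HasDerivAt g g' 0) (n : ℕ) :
    Tendsto (fun ε => coordDiff ε (g ε) n) (𝓝[>] 0) (𝓝 (onceFactor g' n)) := by
  have hc : Tendsto g (𝓝[>] 0) (𝓝 1) :=
    h0 ▸ hg.continuousAt.tendsto.mono_left nhdsWithin_le_nhds
  match n with
  | 0 =>
    have := (hasDerivAt_iff_tendsto_slope_zero.1 hg).mono_left
      (nhdsWithin_mono 0 fun x (hx : 0 < x) => hx.ne')
    refine this.congr fun ε => ?_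
    simp [coordDiff, h0, div_eq_inv_mul]
  | 1 =>
    refine hc.congr' ?_
    filter_upwards [self_mem_nhdsWithin] with ε hε
    have : ε ≠ 0 := ne_of_gt hε
    simp [coordDiff, this]
  | n + 2 =>
    have h1 : Tendsto (fun ε : ℝ => g ε * ε ^ (n + 1)) (𝓝[>] 0) (𝓝 (1 * 0 ^ (n + 1))) :=
      hc.mul (((continuous_pow (n + 1)).tendsto 0).mono_left nhdsWithin_le_nhds)
    rw [zero_pow (by omega), mul_zero] at h1
    refine h1.congr' ?_
    filter_upwards [self_mem_nhdsWithin] with ε hε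
    have : ε ≠ 0 := ne_of_gt hε
    rw [coordDiff, zero_pow (by omega), sub_zero, pow_succ ε (n + 1)]
    field_simp

/-- The alternating sums over small cubes converge to the multilinear coefficient. -/
theorem tendsto_cubeDiff {g : J → ℝ → ℝ} {g' : J → ℝ} (h0 : ∀ j, g j 0 = 1)
    (hg : ∀ j, HasDerivAt (g j) (g' j) 0) (v : I → ℝ) (u : I → J → ℝ) :
    Tendsto (fun ε => cubeDiff ε
      (fun S => (∏ j ∈ S, g j ε) * ∏ i, (v i + ε * ∑ j ∈ S, u i j)))
      (𝓝[>] 0) (𝓝 (matchingSum v g' u)) := by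
  simp only [cubeDiff_expand]
  exact tendsto_finsetSum _ fun θ _ => (tendsto_const_nhds).mul
    (tendsto_finsetProd _ fun j _ => tendsto_coordDiff (h0 j) (hg j) _)

theorem hasDerivAt_one_add_mul (l : ℝ) : HasDerivAt (fun ε : ℝ => 1 + ε * l) l 0 := by
  simpa using ((hasDerivAt_id (0 : ℝ)).mul_const l).const_add 1

theorem hasDerivAt_one_add_mul_exp (l c : ℝ) :
    HasDerivAt (fun ε : ℝ => (1 + ε * l) * Real.exp (ε * c)) (l + c) 0 := by
  have h := (hasDerivAt_one_add_mul l).mul ((((hasDerivAt_id (0 : ℝ)).mul_const c)).exp)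
  convert! h using 1
  simp

theorem coordDiff_nonneg {ε l : ℝ} (hε : 0 < ε) (hl : 0 ≤ l) (n : ℕ) :
    0 ≤ coordDiff ε (1 + ε * l) n := by
  refine div_nonneg ?_ hε.le
  cases n with
  | zero => simp; positivity
  | succ n => rw [zero_pow (by omega), sub_zero]; positivity

theorem coordDiff_mono {ε ε' l : ℝ} (hε : 0 < ε) (hεε : ε ≤ ε') (hl : 0 ≤ l) (n : ℕ) :
    coordDiff ε (1 + ε * l) n ≤ coordDiff ε' (1 + ε' * l) n := by
  have hε' : 0 < ε' := hε.trans_le hεε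
  unfold coordDiff
  cases n with
  | zero => simp [hε.ne', hε'.ne']
  | succ n =>
    rw [zero_pow (by omega), sub_zero, sub_zero, pow_succ, pow_succ, ← mul_assoc, ← mul_assoc,
      mul_div_cancel_right₀ _ hε.ne', mul_div_cancel_right₀ _ hε'.ne']
    gcongr

theorem cubeDiff_nonneg {ε : ℝ} (hε : 0 < ε) {l : J → ℝ} (hl : ∀ j, 0 ≤ l j) {v : I → ℝ}
    {u : I → J → ℝ} (hv : ∀ i, 0 ≤ v i) (hu : ∀ i j, 0 ≤ u i j) :
    0 ≤ cubeDiff ε (fun S => (∏ j ∈ S, (1 + ε * l j)) * ∏ i, (v i + ε * ∑ j ∈ S, u i j)) := by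
  rw [cubeDiff_expand]
  exact sum_nonneg fun θ _ => mul_nonneg (prod_nonneg fun i _ => elim_nonneg (hv i) (hu i) _)
    (prod_nonneg fun j _ => coordDiff_nonneg hε (hl j) _)

/-- Every coefficient beyond the multilinear one is nonnegative, so that the alternating sums
decrease with the cube. This gives a dominating function for the limit. -/
theorem cubeDiff_mono {ε ε' : ℝ} (hε : 0 < ε) (hεε : ε ≤ ε') {l : J → ℝ} (hl : ∀ j, 0 ≤ l j)
    {v : I → ℝ} {u : I → J → ℝ} (hv : ∀ i, 0 ≤ v i) (hu : ∀ i j, 0 ≤ u i j) :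
    cubeDiff ε (fun S => (∏ j ∈ S, (1 + ε * l j)) * ∏ i, (v i + ε * ∑ j ∈ S, u i j)) ≤
      cubeDiff ε' (fun S => (∏ j ∈ S, (1 + ε' * l j)) * ∏ i, (v i + ε' * ∑ j ∈ S, u i j)) := by
  rw [cubeDiff_expand, cubeDiff_expand]
  exact sum_le_sum fun θ _ => mul_le_mul_of_nonneg_left
    (prod_le_prod (fun j _ => coordDiff_nonneg hε (hl j) _)
      fun j _ => coordDiff_mono hε hεε (hl j) _)
    (prod_nonneg fun i _ => elim_nonneg (hv i) (hu i) _)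

end Extraction

/-! ### Set integrals as integrals over the space of all finite tuples -/

section TupleMeasure

variable {Y : Type*} [MeasurableSpace Y]

/-- The measure on tuples of arbitrary length whose integral is the set integral. -/
noncomputable def tupleMeasure (m : Measure Y) : Measure (Σ n : ℕ, Fin n → Y) :=
  Measure.sum fun n => ENNReal.ofReal (1 / (n.factorial : ℝ)) •
    (Measure.pi fun _ : Fin n => m).map (Sigma.mk n)

/-- A function of finite sets, as a function of tuples. -/
noncomputable def onAllTuples (g : Finset Y → ℝ) (y : Σ n : ℕ, Fin n → Y) : ℝ :=
  onTuples g y.1 y.2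

theorem integrable_layer_iff (m : Measure Y) (F : (Σ n : ℕ, Fin n → Y) → ℝ) (n : ℕ) :
    Integrable F (ENNReal.ofReal (1 / (n.factorial : ℝ)) •
      (Measure.pi fun _ : Fin n => m).map (Sigma.mk n)) ↔
    Integrable (fun y : Fin n → Y => F ⟨n, y⟩) (Measure.pi fun _ : Fin n => m) := by
  rw [integrable_smul_measure (by simp; positivity) ENNReal.ofReal_ne_top,
    (measurableEmbedding_sigma_mk n).integrable_map_iff]
  rfl

theorem integral_layer (m : Measure Y) (F : (Σ n : ℕ, Fin n → Y) → ℝ) (n : ℕ) :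
    ∫ y, F y ∂(ENNReal.ofReal (1 / (n.factorial : ℝ)) •
      (Measure.pi fun _ : Fin n => m).map (Sigma.mk n)) =
    (1 / (n.factorial : ℝ)) * ∫ y, F ⟨n, y⟩ ∂(Measure.pi fun _ : Fin n => m) := by
  rw [integral_smul_measure, (measurableEmbedding_sigma_mk n).integral_map,
    ENNReal.toReal_ofReal (by positivity), smul_eq_mul]

theorem integrable_tupleMeasure_iff {m : Measure Y} {F : (Σ n : ℕ, Fin n → Y) → ℝ} :
    Integrable F (tupleMeasure m) ↔
      (∀ n, Integrable (fun y : Fin n → Y => F ⟨n, y⟩) (Measure.pi fun _ : Fin n => m)) ∧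
      Summable fun n : ℕ => (1 / (n.factorial : ℝ)) *
        ∫ y, ‖F ⟨n, y⟩‖ ∂(Measure.pi fun _ : Fin n => m) := by
  rw [tupleMeasure, integrable_sum_measure_iff]
  simp only [integrable_layer_iff, integral_layer m fun y => ‖F y‖]

theorem hasSum_integral_tupleMeasure {m : Measure Y} {F : (Σ n : ℕ, Fin n → Y) → ℝ}
    (hF : Integrable F (tupleMeasure m)) :
    HasSum (fun n : ℕ => (1 / (n.factorial : ℝ)) *
      ∫ y, F ⟨n, y⟩ ∂(Measure.pi fun _ : Fin n => m)) (∫ y, F y ∂tupleMeasure m) := by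
  have h := hasSum_integral_measure hF
  simp only [integral_layer] at h
  exact h

theorem setIntegral_eq {m : Measure Y} {g : Finset Y → ℝ}
    (hg : Integrable (onAllTuples g) (tupleMeasure m)) :
    setIntegral m g = ∫ y, onAllTuples g y ∂tupleMeasure m :=
  (hasSum_integral_tupleMeasure hg).tsum_eq

theorem isSetDensity_iff {m : Measure Y} {g : Finset Y → ℝ} :
    IsSetDensity m g ↔ (∀ W, 0 ≤ g W) ∧ Integrable (onAllTuples g) (tupleMeasure m) ∧
      ∫ y, onAllTuples g y ∂tupleMeasure m = 1 := by
  constructor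
  · intro h
    have hi : Integrable (onAllTuples g) (tupleMeasure m) := by
      refine integrable_tupleMeasure_iff.2 ⟨h.integrable, ?_⟩
      refine h.hasSum.summable.congr fun n => ?_
      congr 1
      refine integral_congr_ae (ae_of_all _ fun y => ?_)
      exact (Real.norm_of_nonneg (h.nonneg _)).symm
    exact ⟨h.nonneg, hi, (hasSum_integral_tupleMeasure hi).unique h.hasSum⟩
  · rintro ⟨h0, hi, h1⟩
    exact ⟨h0, (integrable_tupleMeasure_iff.1 hi).1, h1 ▸ hasSum_integral_tupleMeasure hi⟩

theorem ae_tupleMeasure_iff {m : Measure Y} {p : (Σ n : ℕ, Fin n → Y) → Prop} :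
    (∀ᵐ y ∂tupleMeasure m, p y) ↔
      ∀ n, ∀ᵐ y ∂(Measure.pi fun _ : Fin n => m), p ⟨n, y⟩ := by
  rw [tupleMeasure, Measure.ae_sum_iff]
  refine forall_congr' fun n => ?_
  rw [Measure.ae_ennreal_smul_measure_iff (by simp; positivity),
    (measurableEmbedding_sigma_mk n).ae_map_iff]

theorem ae_injective_tupleMeasure [MeasurableEq Y] (m : Measure Y) [SigmaFinite m]
    [NullSingletonClass m] : ∀ᵐ y ∂tupleMeasure m, Function.Injective y.2 :=
  ae_tupleMeasure_iff.2 fun n => ae_injective_pi m n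

theorem measurable_prod_tuple {v : Y → ℝ} (hv : Measurable v) :
    Measurable fun y : Σ n : ℕ, Fin n → Y => ∏ i, v (y.2 i) :=
  measurable_sigma_iff.2 fun n => by
    change Measurable fun a : Fin n → Y => ∏ i, v (a i)
    fun_prop

omit [MeasurableSpace Y] in
/-- Over a tuple without repetitions the product over the set is the product over the tuple. -/
theorem onAllTuples_prod_mul (h : Y → ℝ) (g : Finset Y → ℝ)
    {y : Σ n : ℕ, Fin n → Y} (hy : Function.Injective y.2) :
    onAllTuples (fun W => (∏ x ∈ W, h x) * g W) y = (∏ i, h (y.2 i)) * onAllTuples g y := by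
  simp only [onAllTuples, onTuples]
  congr 1
  classical exact prod_image fun i _ j _ hij => hy hij

theorem hasSum_exp_series (c : ℝ) :
    HasSum (fun n : ℕ => (1 / (n.factorial : ℝ)) * c ^ n) (Real.exp c) := by
  rw [Real.exp_eq_exp_ℝ]
  simpa [div_eq_inv_mul] using NormedSpace.exp_series_hasSum_exp' (𝕂 := ℝ) c

/-- The Poisson case: products of an integrable function over all tuples. -/
theorem integral_prod_tupleMeasure {m : Measure Y} [SigmaFinite m] {v : Y → ℝ}
    (hv : Integrable v m) :
    Integrable (fun y : Σ n : ℕ, Fin n → Y => ∏ i, v (y.2 i)) (tupleMeasure m) ∧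
      ∫ y, ∏ i, v (y.2 i) ∂tupleMeasure m = Real.exp (∫ x, v x ∂m) := by
  have hi : Integrable (fun y : Σ n : ℕ, Fin n → Y => ∏ i, v (y.2 i)) (tupleMeasure m) := by
    refine integrable_tupleMeasure_iff.2 ⟨fun n => ?_, ?_⟩
    · exact Integrable.fintype_prod (f := fun _ : Fin n => v) fun _ => hv
    have h : ∀ n : ℕ, ∫ y : Fin n → Y, ‖∏ i, v (y i)‖ ∂(Measure.pi fun _ : Fin n => m) =
        (∫ x, ‖v x‖ ∂m) ^ n := fun n => by
      simpa using integral_fintype_prod_eq_pow (μ := m) (ι := Fin n) fun x => ‖v x‖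
    simp only [h]
    exact (hasSum_exp_series _).summable
  refine ⟨hi, (hasSum_integral_tupleMeasure hi).unique ?_⟩
  have h : ∀ n : ℕ, ∫ y : Fin n → Y, ∏ i, v (y i) ∂(Measure.pi fun _ : Fin n => m) =
      (∫ x, v x ∂m) ^ n := fun n => by
    simpa using integral_fintype_prod_eq_pow (μ := m) (ι := Fin n) v
  simp only [h]
  exact hasSum_exp_series _

/-- If the integrals of `w(y) ∏ i, (v (y i) + ε ∑ j ∈ S, u j (y i))` are finite for small `ε`, then
the integral of the multilinear coefficient is the multilinear coefficient of the integrals. -/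
theorem integral_matchingSum {J : Type*} [Fintype J] (M : Measure (Σ n : ℕ, Fin n → Y))
    {w : (Σ n : ℕ, Fin n → Y) → ℝ} (hw : ∀ y, 0 ≤ w y)
    {v : Y → ℝ} (hv : ∀ y, 0 ≤ v y) {l : J → ℝ} (hl : ∀ j, 0 ≤ l j)
    {u : J → Y → ℝ} (hu : ∀ j y, 0 ≤ u j y) {ε₀ : ℝ} (hε₀ : 0 < ε₀)
    (hint : ∀ ε ∈ Set.Ioc 0 ε₀, ∀ S : Finset J,
      Integrable (fun y => w y * ∏ i, (v (y.2 i) + ε * ∑ j ∈ S, u j (y.2 i))) M)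
    {L : ℝ} (hL : Tendsto (fun ε => cubeDiff ε fun S : Finset J => (∏ j ∈ S, (1 + ε * l j)) *
      ∫ y, w y * ∏ i, (v (y.2 i) + ε * ∑ j ∈ S, u j (y.2 i)) ∂M) (𝓝[>] 0) (𝓝 L)) :
    Integrable (fun y => w y * matchingSum (fun i => v (y.2 i)) l fun i j => u j (y.2 i)) M ∧
      ∫ y, w y * matchingSum (fun i => v (y.2 i)) l (fun i j => u j (y.2 i)) ∂M = L := by
  set H : ℝ → (Σ n : ℕ, Fin n → Y) → ℝ := fun ε y => w y * cubeDiff ε fun S : Finset J =>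
    (∏ j ∈ S, (1 + ε * l j)) * ∏ i, (v (y.2 i) + ε * ∑ j ∈ S, u j (y.2 i)) with hH
  have hH' : ∀ ε, H ε = fun y => ∑ S : Finset J, (-1) ^ #(open Classical in Sᶜ) *
      (∏ j ∈ S, (1 + ε * l j)) / ε ^ Fintype.card J *
      (w y * ∏ i, (v (y.2 i) + ε * ∑ j ∈ S, u j (y.2 i))) := by
    intro ε
    funext y
    simp only [hH, cubeDiff, mul_sum]
    refine sum_congr rfl fun S _ => ?_
    ring
  have hHint : ∀ ε ∈ Set.Ioc 0 ε₀, Integrable (H ε) M := by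
    intro ε hε
    rw [hH']
    exact integrable_finsetSum _ fun S _ => (hint ε hε S).const_mul _
  have hHval : ∀ ε ∈ Set.Ioc 0 ε₀, ∫ y, H ε y ∂M = cubeDiff ε fun S : Finset J =>
      (∏ j ∈ S, (1 + ε * l j)) *
      ∫ y, w y * ∏ i, (v (y.2 i) + ε * ∑ j ∈ S, u j (y.2 i)) ∂M := by
    intro ε hε
    rw [hH', integral_finsetSum _ fun S _ => (hint ε hε S).const_mul _, cubeDiff]
    refine sum_congr rfl fun S _ => ?_
    rw [integral_const_mul]
    ring
  have hev : ∀ᶠ ε : ℝ in 𝓝[>] 0, ε ∈ Set.Ioc 0 ε₀ := Ioc_mem_nhdsGT hε₀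
  have hlim : ∀ y, Tendsto (fun ε => H ε y) (𝓝[>] 0)
      (𝓝 (w y * matchingSum (fun i => v (y.2 i)) l fun i j => u j (y.2 i))) := fun y =>
    tendsto_const_nhds.mul (tendsto_cubeDiff (g := fun j ε => 1 + ε * l j) (by simp)
      (fun j => hasDerivAt_one_add_mul (l j)) _ _)
  have hbound : ∀ ε ∈ Set.Ioc 0 ε₀, ∀ y, ‖H ε y‖ ≤ H ε₀ y := by
    intro ε hε y
    rw [Real.norm_of_nonneg (mul_nonneg (hw y) (cubeDiff_nonneg hε.1 hl (fun i => hv _)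
      fun i j => hu _ _))]
    exact mul_le_mul_of_nonneg_left (cubeDiff_mono hε.1 hε.2 hl (fun i => hv _)
      fun i j => hu _ _) (hw y)
  have hmeas : AEStronglyMeasurable
      (fun y => w y * matchingSum (fun i => v (y.2 i)) l fun i j => u j (y.2 i)) M := by
    -- measurability passes to limits of sequences, so `ε` runs through a sequence here
    have hseq : Tendsto (fun n : ℕ => ε₀ / ((n : ℝ) + 1)) atTop (𝓝[>] 0) := by
      refine tendsto_nhdsWithin_iff.2 ⟨?_, Eventually.of_forall fun n => ?_⟩
      · exact tendsto_const_nhds.div_atTop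
          (tendsto_atTop_add_const_right _ _ tendsto_natCast_atTop_atTop)
      · exact div_pos hε₀ (by positivity)
    refine aestronglyMeasurable_of_tendsto_ae atTop (f := fun n : ℕ => H (ε₀ / ((n : ℝ) + 1)))
      (fun n => (hHint _ ⟨div_pos hε₀ (by positivity), ?_⟩).aestronglyMeasurable)
      (ae_of_all _ fun y => (hlim y).comp hseq)
    exact div_le_self hε₀.le (by linarith [(Nat.cast_nonneg n : (0 : ℝ) ≤ n)])
  refine ⟨(hHint ε₀ ⟨hε₀, le_rfl⟩).mono' hmeas (ae_of_all _ fun y => ?_), ?_⟩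
  · exact le_of_tendsto (hlim y).norm (hev.mono fun ε hε => hbound ε hε y)
  · refine tendsto_nhds_unique (tendsto_integral_filter_of_dominated_convergence (H ε₀)
      (hev.mono fun ε hε => (hHint ε hε).aestronglyMeasurable)
      (hev.mono fun ε hε => ae_of_all _ (hbound ε hε)) (hHint ε₀ ⟨hε₀, le_rfl⟩)
      (ae_of_all _ hlim)) (hL.congr' (hev.mono fun ε hε => (hHval ε hε).symm))

end TupleMeasure

/-! ### The measurement likelihood -/

/-- The enumeration of the image of an injective tuple. -/
noncomputable def imageEquiv {Y : Type*} [DecidableEq Y] {n : ℕ} (y : Fin n → Y)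
    (hy : Function.Injective y) :
    Fin n ≃ ↥(univ.image y) :=
  Equiv.ofBijective (fun i => ⟨y i, mem_image_of_mem y (mem_univ i)⟩)
    ⟨fun i j h => hy (congrArg Subtype.val h), fun ⟨x, hx⟩ => by
      obtain ⟨i, -, rfl⟩ := mem_image.1 hx
      exact ⟨i, rfl⟩⟩

namespace SensorModel

variable {X Z : Type*} [MeasurableSpace X] [MeasurableSpace Z] {ν : Measure Z}
  (S : SensorModel X Z ν) {k : ℕ}

theorem trajPD_nonneg (x : Traj X k) : 0 ≤ S.trajPD x := by
  unfold trajPD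
  split_ifs
  exacts [S.pd_nonneg _, le_rfl]

theorem trajPD_le_one (x : Traj X k) : S.trajPD x ≤ 1 := by
  unfold trajPD
  split_ifs
  exacts [S.pd_le_one _, zero_le_one]

theorem measurable_trajPD : Measurable (S.trajPD : Traj X k → ℝ) :=
  Measurable.ite (measurable_endTime (measurableSet_singleton k))
    (S.pd_measurable.comp measurable_lastState) measurable_const

theorem trajLik_nonneg (z : Z) (x : Traj X k) : 0 ≤ S.trajLik z x := S.lik_nonneg _ _

theorem measurable_trajLik (z : Z) : Measurable (S.trajLik z : Traj X k → ℝ) :=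
  S.lik_measurable.comp (measurable_const.prodMk measurable_lastState)

theorem integrable_trajLik (x : Traj X k) : Integrable (fun z => S.trajLik z x) ν :=
  Integrable.of_integral_ne_zero (by
    simp only [trajLik, S.lik_integral]
    exact one_ne_zero)

/-- A Bernoulli density on a set of measurements, as a product over its elements. -/
theorem detectionDensity_eq (x : Traj X k) (W : Finset Z) :
    S.detectionDensity x W =
      onceFactor (1 - S.trajPD x) #W * ∏ z ∈ W, S.trajPD x * S.trajLik z x := by
  unfold detectionDensity
  split_ifs with h1 h2
  · simp [h1, onceFactor]
  · obtain ⟨z, rfl⟩ := card_eq_one.1 h2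
    simp [onceFactor]
  · have h3 : #W ≠ 0 := fun h => h1 (card_eq_zero.1 h)
    obtain ⟨n, hn⟩ := Nat.exists_eq_add_of_le' (show 2 ≤ #W by omega)
    rw [hn]
    simp [onceFactor]

/-- The likelihood is a sum over the matchings of measurements with targets, where an unmatched
measurement is clutter and an unmatched target is missed. -/
theorem likelihood_eq (W : Finset Z) (A : Finset (Traj X k)) :
    S.likelihood W A = Real.exp (-∫ z, S.clutter z ∂ν) *
      matchingSum (fun z : ↥W => S.clutter z) (fun x : ↥A => 1 - S.trajPD x.1)
        fun z x => S.trajPD x.1 * S.trajLik z.1 x.1 := by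
  classical
  rw [likelihood, unionDensity, matchingSum, mul_sum]
  refine sum_congr (by congr; exact Subsingleton.elim _ _) fun θ _ => ?_
  have h1 : ∏ z : ↥W, (θ z).elim (S.clutter z.1) (fun x => S.trajPD x.1 * S.trajLik z.1 x.1) =
      (∏ z : ↥W with θ z = none, S.clutter z.1) *
        ∏ x : ↥A, ∏ z : ↥W with θ z = some x, S.trajPD x.1 * S.trajLik z.1 x.1 := by
    rw [← prod_fiberwise univ θ, Fintype.prod_option]
    congr 1
    · refine prod_congr rfl fun z hz => ?_
      rw [(mem_filter.1 hz).2]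
      rfl
    · refine prod_congr rfl fun x _ => prod_congr rfl fun z hz => ?_
      rw [(mem_filter.1 hz).2]
      rfl
  rw [h1, Fintype.prod_option]
  simp only [Option.elim, detectionDensity_eq, pppDensity, prod_map, card_map,
    Function.Embedding.subtype_apply]
  rw [prod_mul_distrib, mul_assoc, mul_assoc, mul_comm (∏ x : ↥A, onceFactor _ _)]
  congr!

theorem likelihood_nonneg (W : Finset Z) (A : Finset (Traj X k)) : 0 ≤ S.likelihood W A := by
  rw [likelihood_eq]
  exact mul_nonneg (Real.exp_pos _).le (matchingSum_nonneg (fun _ => S.clutter_nonneg _)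
    (fun _ => sub_nonneg.2 (S.trajPD_le_one _))
    fun _ _ => mul_nonneg (S.trajPD_nonneg _) (S.trajLik_nonneg _ _))

theorem likelihood_image [DecidableEq Z] {n : ℕ} {z : Fin n → Z} (hz : Function.Injective z)
    (A : Finset (Traj X k)) :
    S.likelihood (univ.image z) A = Real.exp (-∫ z, S.clutter z ∂ν) *
      matchingSum (fun i => S.clutter (z i)) (fun x : ↥A => 1 - S.trajPD x.1)
        fun i x => S.trajPD x.1 * S.trajLik (z i) x.1 := by
  rw [likelihood_eq]
  exact congrArg _ (matchingSum_reindex (imageEquiv z hz) (Equiv.refl _) _ _ _).symm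

/-- The likelihood as a sum over the matchings of targets with measurements, with the targets on the
side that is expanded over when the set of targets is integrated out. -/
theorem likelihood_image_image [DecidableEq Z] [instTraj : DecidableEq (Traj X k)] {m n : ℕ}
    {z : Fin m → Z} (hz : Function.Injective z)
    {y : Fin n → Traj X k} (hy : Function.Injective y) :
    S.likelihood (univ.image z) (univ.image y) = Real.exp (-∫ z, S.clutter z ∂ν) *
      matchingSum (fun i => 1 - S.trajPD (y i)) (fun j => S.clutter (z j))
        fun i j => S.trajPD (y i) * S.trajLik (z j) (y i) := by
  rw [likelihood_image S hz, matchingSum_symm]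
  rw [← matchingSum_reindex (imageEquiv y hy) (Equiv.refl (Fin m))]
  rfl

end SensorModel

theorem IsTestFunction.integrable_mul {Y : Type*} [MeasurableSpace Y] {m : Measure Y} {g f : Y → ℝ}
    (hg : IsTestFunction g) (hf : Integrable f m) : Integrable (fun y => f y * g y) m :=
  hf.mul_bdd (c := 1) hg.measurable.aestronglyMeasurable (ae_of_all _ fun y => by
    rw [Real.norm_of_nonneg (hg.nonneg y)]
    exact hg.le_one y)

theorem isTestFunction_one {Y : Type*} [MeasurableSpace Y] : IsTestFunction fun _ : Y => 1 :=
  ⟨measurable_const, fun _ => zero_le_one, fun _ => le_rfl⟩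

namespace SensorModel

variable {X Z : Type*} [MeasurableSpace X] [MeasurableSpace Z] {ν : Measure Z}
  (S : SensorModel X Z ν) {k : ℕ}

/-- The generating functional of the measurement set, as an integral over all tuples. -/
theorem integral_likelihood [MeasurableEq Z] [SigmaFinite ν] [NullSingletonClass ν]
    (A : Finset (Traj X k)) {g : Z → ℝ} (hg : IsTestFunction g) :
    Integrable (onAllTuples fun W => (∏ z ∈ W, g z) * S.likelihood W A) (tupleMeasure ν) ∧
    ∫ y, onAllTuples (fun W => (∏ z ∈ W, g z) * S.likelihood W A) y ∂tupleMeasure ν =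
      Real.exp (pair ν S.clutter fun z => g z - 1) *
        ∏ x ∈ A, (1 - S.trajPD x + S.trajPD x * pair ν (fun z => S.trajLik z x) g) := by
  classical
  set v : Z → ℝ := fun z => g z * S.clutter z with hv
  set u : ↥A → Z → ℝ := fun x z => g z * (S.trajPD x.1 * S.trajLik z x.1) with hu
  have hvi : Integrable v ν := by
    simpa only [hv, mul_comm] using hg.integrable_mul S.clutter_integrable
  have hui : ∀ x, Integrable (u x) ν := fun x => by
    simpa only [hu, mul_comm (g _)] using
      hg.integrable_mul ((S.integrable_trajLik x.1).const_mul (S.trajPD x.1))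
  have hint : ∀ (ε : ℝ) (s : Finset ↥A), Integrable (fun z => v z + ε * ∑ x ∈ s, u x z) ν :=
    fun ε s => hvi.add ((integrable_finsetSum s fun x _ => hui x).const_mul ε)
  have hval : ∀ (ε : ℝ) (s : Finset ↥A), ∫ z, v z + ε * ∑ x ∈ s, u x z ∂ν =
      (∫ z, v z ∂ν) + ∑ x ∈ s, ε * ∫ z, u x z ∂ν := fun ε s => by
    rw [integral_add hvi ((integrable_finsetSum s fun x _ => hui x).const_mul ε),
      integral_const_mul, integral_finsetSum s fun x _ => hui x, mul_sum]
  -- the matchings are those of measurements with targets: a target that is not chosen is missed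
  obtain ⟨hi, hI⟩ := integral_matchingSum (tupleMeasure ν) (w := fun _ => 1)
    (fun _ => zero_le_one) (v := v) (fun z => mul_nonneg (hg.nonneg z) (S.clutter_nonneg z))
    (l := fun x : ↥A => 1 - S.trajPD x.1) (fun x => sub_nonneg.2 (S.trajPD_le_one _)) (u := u)
    (fun x z => mul_nonneg (hg.nonneg z) (mul_nonneg (S.trajPD_nonneg _) (S.trajLik_nonneg _ _)))
    one_pos (fun ε _ s => by
      simpa only [one_mul] using (integral_prod_tupleMeasure (hint ε s)).1)
    (L := Real.exp (∫ z, v z ∂ν) *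
      ∏ x : ↥A, (1 - S.trajPD x.1 + ∫ z, u x z ∂ν)) (by
      -- without a product over tracks, only the coordinatewise factors remain
      have h := (tendsto_cubeDiff (I := Empty)
        (g := fun (x : ↥A) ε => (1 + ε * (1 - S.trajPD x.1)) * Real.exp (ε * ∫ z, u x z ∂ν))
        (by simp) (fun x => hasDerivAt_one_add_mul_exp _ _) (fun _ => 0)
        fun _ _ => 0).const_mul (Real.exp (∫ z, v z ∂ν))
      convert! h using 1
      · funext ε
        simp only [one_mul, fun s => (integral_prod_tupleMeasure (hint ε s)).2, hval, Real.exp_add,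
          Real.exp_sum, univ_eq_empty, prod_empty, mul_one, prod_mul_distrib]
        rw [cubeDiff, cubeDiff, mul_sum]
        refine sum_congr rfl fun s _ => ?_
        ring
      · simp [matchingSum, onceFactor])
  have hae : ∀ᵐ y ∂tupleMeasure ν, Real.exp (-∫ z, S.clutter z ∂ν) *
      (1 * matchingSum (fun i => v (y.2 i)) (fun x : ↥A => 1 - S.trajPD x.1)
        fun i x => u x (y.2 i)) =
      onAllTuples (fun W => (∏ z ∈ W, g z) * S.likelihood W A) y := by
    filter_upwards [ae_injective_tupleMeasure ν] with y hy
    rw [onAllTuples_prod_mul _ _ hy, one_mul, onAllTuples, onTuples, likelihood_image S hy,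
      hv, hu, matchingSum_mul_left]
    ring
  refine ⟨(hi.const_mul _).congr hae, ?_⟩
  rw [← integral_congr_ae hae, integral_const_mul, hI, ← mul_assoc, ← Real.exp_add]
  rw [← prod_coe_sort A]
  congr 1
  · congr 1
    rw [neg_add_eq_sub, ← integral_sub hvi S.clutter_integrable, pair]
    refine integral_congr_ae (ae_of_all _ fun z => ?_)
    simp only [hv]
    ring
  · refine prod_congr rfl fun x _ => ?_
    congr 1
    rw [pair, ← integral_const_mul]
    refine integral_congr_ae (ae_of_all _ fun z => ?_)
    simp only [hu]
    ring

/-- The measurement model is a set density with the point-target generating functional. -/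
theorem isSetDensity_likelihood [MeasurableEq Z] [SigmaFinite ν] [NullSingletonClass ν]
    (A : Finset (Traj X k)) : IsSetDensity ν fun W => S.likelihood W A := by
  obtain ⟨hi, hI⟩ := S.integral_likelihood A isTestFunction_one
  simp only [prod_const_one, one_mul] at hi hI
  refine isSetDensity_iff.2 ⟨fun W => S.likelihood_nonneg W A, hi, hI.trans ?_⟩
  simp [pair, trajLik, S.lik_integral]

theorem pgfl_likelihood [MeasurableEq Z] [SigmaFinite ν] [NullSingletonClass ν]
    (A : Finset (Traj X k)) {g : Z → ℝ} (hg : IsTestFunction g) :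
    pgfl ν (fun W => S.likelihood W A) g = Real.exp (pair ν S.clutter fun z => g z - 1) *
      ∏ x ∈ A, (1 - S.trajPD x + S.trajPD x * pair ν (fun z => S.trajLik z x) g) := by
  obtain ⟨hi, hI⟩ := S.integral_likelihood A hg
  exact (setIntegral_eq hi).trans hI

end SensorModel

/-! ### Extracting the coefficient from the generating functional of the prediction -/

/-- Monotone convergence for nonnegative real functions: integrability of the limit follows from
convergence of the integrals. -/
theorem integral_eq_of_monotone_tendsto {Ω : Type*} [MeasurableSpace Ω] {M : Measure Ω}
    {F : ℕ → Ω → ℝ} {G : Ω → ℝ} {R : ℝ} (hF : ∀ n, Integrable (F n) M) (h0 : ∀ n x, 0 ≤ F n x)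
    (hmono : ∀ x, Monotone fun n => F n x) (hG : ∀ x, Tendsto (fun n => F n x) atTop (𝓝 (G x)))
    (hR : Tendsto (fun n => ∫ x, F n x ∂M) atTop (𝓝 R)) :
    Integrable G M ∧ ∫ x, G x ∂M = R := by
  have hGm : AEStronglyMeasurable G M := aestronglyMeasurable_of_tendsto_ae atTop
    (fun n => (hF n).aestronglyMeasurable) (ae_of_all _ hG)
  have hG0 : ∀ x, 0 ≤ G x := fun x => ge_of_tendsto' (hG x) fun n => h0 n x
  have hR0 : 0 ≤ R := ge_of_tendsto' hR fun n => integral_nonneg (h0 n)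
  have h1 := lintegral_tendsto_of_tendsto_of_monotone
    (f := fun n x => ENNReal.ofReal (F n x)) (F := fun x => ENNReal.ofReal (G x)) (μ := M)
    (fun n => (hF n).aestronglyMeasurable.aemeasurable.ennreal_ofReal)
    (ae_of_all _ fun x _ _ hnm => ENNReal.ofReal_le_ofReal (hmono x hnm))
    (ae_of_all _ fun x => (ENNReal.continuous_ofReal.tendsto _).comp (hG x))
  have h2 : ∫⁻ x, ENNReal.ofReal (G x) ∂M = ENNReal.ofReal R := by
    refine tendsto_nhds_unique h1 ?_
    refine ((ENNReal.continuous_ofReal.tendsto _).comp hR).congr fun n => ?_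
    exact ofReal_integral_eq_lintegral_ofReal (hF n) (ae_of_all _ (h0 n))
  have h3 : Integrable G M := (lintegral_ofReal_ne_top_iff_integrable hGm (ae_of_all _ hG0)).1
    (h2 ▸ ENNReal.ofReal_ne_top)
  refine ⟨h3, ?_⟩
  rw [integral_eq_lintegral_of_nonneg_ae (ae_of_all _ hG0) hGm, h2, ENNReal.toReal_ofReal hR0]

namespace PMBM

variable {T : Type*} [MeasurableSpace T] {J : Type*} [Fintype J]

/-- The coefficient of `∏ j, s j` in `∏ j, (1 + s j * l j)` times the PMBM functional at
`v + ∑ j, s j * u j`. -/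
noncomputable def multilinearCoeff (P : PMBM T) (m : Measure T) (v : T → ℝ) (l : J → ℝ)
    (u : J → T → ℝ) : ℝ :=
  Real.exp (pair m P.lam fun x => v x - 1) * ∑ a ∈ P.globalHyps, P.weight a *
    matchingSum (fun i : ↥(Finset.Icc 1 P.n) => 1 - P.r i (a i) + P.r i (a i) * pair m (P.f i (a i)) v)
      (fun j => l j + pair m P.lam (u j)) fun i j => P.r i (a i) * pair m (P.f i (a i)) (u j)

variable {P : PMBM T} {m : Measure T} {t : ℕ}

omit [MeasurableSpace T] in
theorem mem_hyps_of_mem_globalHyps {a : ↥(Finset.Icc 1 P.n) → ℕ} (ha : a ∈ P.globalHyps)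
    (i : ↥(Finset.Icc 1 P.n)) : a i ∈ Finset.Icc 1 (P.h i) := by
  classical
  exact Fintype.mem_piFinset.1 (mem_filter.1 ha).1 i

omit [MeasurableSpace T] in
theorem w_ne_zero_of_weight_ne_zero {a : ↥(Finset.Icc 1 P.n) → ℕ} (ha : P.weight a ≠ 0)
    (i : ↥(Finset.Icc 1 P.n)) : P.w i (a i) ≠ 0 := by
  have h : P.rawWeight a ≠ 0 := fun h => ha (by rw [weight, h, zero_div])
  exact prod_ne_zero_iff.1 h i (mem_univ i)

omit [Fintype J] in
/-- The PMBM functional along the rays on which the cube differences are taken. Hypotheses whose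
parameters are not constrained have weight zero or probability of existence zero. -/
theorem genFun_affine (hP : P.WellFormed m t) {v : T → ℝ} (hv : IsTestFunction v)
    {u : J → T → ℝ} (hlam : ∀ j, Integrable (fun x => P.lam x * u j x) m)
    (hf : ∀ i ∈ Finset.Icc 1 P.n, ∀ a ∈ Finset.Icc 1 (P.h i), P.w i a ≠ 0 → P.r i a ≠ 0 →
      ∀ j, Integrable (fun x => P.f i a x * u j x) m) (ε : ℝ) (S : Finset J) :
    P.genFun m (fun x => v x + ε * ∑ j ∈ S, u j x) =
      ∑ a ∈ P.globalHyps, (Real.exp (pair m P.lam fun x => v x - 1) * P.weight a) *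
        ((∏ j ∈ S, Real.exp (ε * pair m P.lam (u j))) *
        ∏ i : ↥(Finset.Icc 1 P.n),
          ((1 - P.r i (a i) + P.r i (a i) * pair m (P.f i (a i)) v) +
            ε * ∑ j ∈ S, P.r i (a i) * pair m (P.f i (a i)) (u j))) := by
  have hpair : ∀ g : T → ℝ, Integrable g m → (∀ j, Integrable (fun x => g x * u j x) m) →
      Integrable (fun x => g x * (ε * ∑ j ∈ S, u j x)) m ∧
      ∫ x, g x * (ε * ∑ j ∈ S, u j x) ∂m = ∑ j ∈ S, ε * pair m g (u j) := by
    intro g hg hgu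
    have h1 : (fun x => g x * (ε * ∑ j ∈ S, u j x)) =
        fun x => ∑ j ∈ S, ε * (g x * u j x) := by
      funext x
      rw [mul_left_comm, mul_sum, mul_sum]
    rw [h1, integral_finsetSum _ fun j _ => (hgu j).const_mul ε]
    refine ⟨integrable_finsetSum _ fun j _ => (hgu j).const_mul ε, ?_⟩
    exact sum_congr rfl fun j _ => integral_const_mul _ _
  have hexp : Real.exp (pair m P.lam fun x => v x + ε * ∑ j ∈ S, u j x - 1) =
      Real.exp (pair m P.lam fun x => v x - 1) *
        ∏ j ∈ S, Real.exp (ε * pair m P.lam (u j)) := by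
    obtain ⟨h1, h2⟩ := hpair P.lam hP.lam_integrable hlam
    rw [← Real.exp_sum, ← Real.exp_add, ← h2, pair, pair, ← integral_add _ h1]
    · congr 1
      refine integral_congr_ae (ae_of_all _ fun x => ?_)
      ring
    · refine ((hv.integrable_mul hP.lam_integrable).sub hP.lam_integrable).congr
        (ae_of_all _ fun x => ?_)
      simp only [Pi.sub_apply]
      ring
  rw [genFun, hexp, mul_sum]
  refine sum_congr rfl fun a ha => ?_
  by_cases hw : P.weight a = 0
  · simp [hw]
  have hfac : ∀ i : ↥(Finset.Icc 1 P.n), 1 - P.r i (a i) + P.r i (a i) *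
      pair m (P.f i (a i)) (fun x => v x + ε * ∑ j ∈ S, u j x) =
      (1 - P.r i (a i) + P.r i (a i) * pair m (P.f i (a i)) v) +
        ε * ∑ j ∈ S, P.r i (a i) * pair m (P.f i (a i)) (u j) := by
    intro i
    by_cases hr : P.r i (a i) = 0
    · simp [hr]
    have hi := mem_hyps_of_mem_globalHyps ha i
    have hwi := w_ne_zero_of_weight_ne_zero hw i
    have hd := hP.f_density i i.2 _ hi hwi hr
    obtain ⟨h1, h2⟩ := hpair _ hd.2.2.1 (hf i i.2 _ hi hwi hr)
    have h3 : pair m (P.f i (a i)) (fun x => v x + ε * ∑ j ∈ S, u j x) =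
        pair m (P.f i (a i)) v + ∑ j ∈ S, ε * pair m (P.f i (a i)) (u j) := by
      rw [← h2, pair, pair, ← integral_add (hv.integrable_mul hd.2.2.1) h1]
      refine integral_congr_ae (ae_of_all _ fun x => ?_)
      ring
    rw [h3, mul_add, mul_sum, mul_sum, add_assoc]
    congr 2
    exact sum_congr rfl fun j _ => mul_left_comm _ _ _
  rw [prod_congr rfl fun i _ => hfac i]
  ring

/-- The generating functional of the prediction, as an integral over all tuples. -/
theorem integral_prod_mul_density {g : Finset T → ℝ} [MeasurableEq T] [SigmaFinite m]
    [NullSingletonClass m] (hg : P.IsDistribution m t g) {h : T → ℝ} (hh : IsTestFunction h) :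
    Integrable (fun y => onAllTuples g y * ∏ i, h (y.2 i)) (tupleMeasure m) ∧
      ∫ y, onAllTuples g y * ∏ i, h (y.2 i) ∂tupleMeasure m = P.genFun m h := by
  obtain ⟨-, hi, -⟩ := isSetDensity_iff.1 hg.isSetDensity
  have h1 : Integrable (fun y => onAllTuples g y * ∏ i, h (y.2 i)) (tupleMeasure m) :=
    hi.mul_bdd (c := 1) (measurable_prod_tuple hh.measurable).aestronglyMeasurable
      (ae_of_all _ fun y => by
        rw [norm_prod]
        refine prod_le_one (fun i _ => norm_nonneg _) fun i _ => ?_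
        rw [Real.norm_of_nonneg (hh.nonneg _)]
        exact hh.le_one _)
  have hae : (fun y => onAllTuples g y * ∏ i, h (y.2 i)) =ᵐ[tupleMeasure m]
      onAllTuples fun W => (∏ x ∈ W, h x) * g W := by
    filter_upwards [ae_injective_tupleMeasure m] with y hy
    rw [onAllTuples_prod_mul _ _ hy, mul_comm]
  refine ⟨h1, ?_⟩
  rw [← hg.pgfl_eq h hh, integral_congr_ae hae]
  exact (setIntegral_eq (h1.congr hae)).symm

theorem tendsto_pair_min {f b q : T → ℝ} (hf : Measurable f) (hb : Measurable b)
    (hq : Measurable q) (hq0 : ∀ x, 0 ≤ q x)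
    (hi : Integrable (fun x => f x * (q x * b x)) m) :
    Tendsto (fun N : ℕ => pair m f fun x => min (q x) N * b x) atTop
      (𝓝 (pair m f fun x => q x * b x)) := by
  refine tendsto_integral_of_dominated_convergence (fun x => ‖f x * (q x * b x)‖)
    (fun N => (hf.mul ((hq.min measurable_const).mul hb)).aestronglyMeasurable) hi.norm
    (fun N => ae_of_all _ fun x => ?_) (ae_of_all _ fun x => ?_)
  · have h0 : 0 ≤ min (q x) (N : ℝ) := le_min (hq0 x) N.cast_nonneg
    simp only [norm_mul, Real.norm_of_nonneg h0, Real.norm_of_nonneg (hq0 x)]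
    gcongr
    exact min_le_left _ _
  · refine tendsto_const_nhds.congr' ?_
    filter_upwards [eventually_ge_atTop ⌈q x⌉₊] with N hN
    rw [min_eq_left ((Nat.le_ceil _).trans (Nat.cast_le.2 hN))]

theorem integrable_mul_min {f b q : T → ℝ} (hf : Measurable f) (hb : Measurable b)
    (hq : Measurable q) (hq0 : ∀ x, 0 ≤ q x)
    (hi : Integrable (fun x => f x * (q x * b x)) m) (N : ℕ) :
    Integrable (fun x => f x * (min (q x) N * b x)) m := by
  refine hi.mono (hf.mul ((hq.min measurable_const).mul hb)).aestronglyMeasurable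
    (ae_of_all _ fun x => ?_)
  have h0 : 0 ≤ min (q x) (N : ℝ) := le_min (hq0 x) N.cast_nonneg
  simp only [norm_mul, Real.norm_of_nonneg h0, Real.norm_of_nonneg (hq0 x)]
  gcongr
  exact min_le_left _ _

variable [MeasurableEq T] [SigmaFinite m] [NullSingletonClass m]

/-- The extraction when small multiples of the weights of matched pairs stay within the test
functions, where the generating functional of the prediction is known. -/
theorem integral_density_matchingSum_of_isTestFunction {g : Finset T → ℝ}
    (hg : P.IsDistribution m t g) {v : T → ℝ} (hv : IsTestFunction v) {l : J → ℝ}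
    (hl : ∀ j, 0 ≤ l j) {u : J → T → ℝ} (hu : ∀ j x, 0 ≤ u j x)
    (hlam : ∀ j, Integrable (fun x => P.lam x * u j x) m)
    (hf : ∀ i ∈ Finset.Icc 1 P.n, ∀ a ∈ Finset.Icc 1 (P.h i), P.w i a ≠ 0 → P.r i a ≠ 0 →
      ∀ j, Integrable (fun x => P.f i a x * u j x) m)
    {ε₀ : ℝ} (hε₀ : 0 < ε₀) (htest : ∀ ε ∈ Set.Ioc 0 ε₀, ∀ S : Finset J,
      IsTestFunction fun x => v x + ε * ∑ j ∈ S, u j x) :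
    Integrable (fun y => onAllTuples g y *
        matchingSum (fun i => v (y.2 i)) l fun i j => u j (y.2 i)) (tupleMeasure m) ∧
      ∫ y, onAllTuples g y * matchingSum (fun i => v (y.2 i)) l (fun i j => u j (y.2 i))
        ∂tupleMeasure m = P.multilinearCoeff m v l u := by
  refine integral_matchingSum _ (w := onAllTuples g) (fun y => hg.isSetDensity.nonneg _) hv.nonneg hl hu hε₀
    (fun ε hε S => (integral_prod_mul_density hg (htest ε hε S)).1) ?_
  have h1 : Tendsto (fun ε => ∑ a ∈ P.globalHyps,
      (Real.exp (pair m P.lam fun x => v x - 1) * P.weight a) * cubeDiff ε fun S : Finset J =>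
        (∏ j ∈ S, (1 + ε * l j) * Real.exp (ε * pair m P.lam (u j))) *
        ∏ i : ↥(Finset.Icc 1 P.n),
          ((1 - P.r i (a i) + P.r i (a i) * pair m (P.f i (a i)) v) +
            ε * ∑ j ∈ S, P.r i (a i) * pair m (P.f i (a i)) (u j))) (𝓝[>] 0)
      (𝓝 (P.multilinearCoeff m v l u)) := by
    rw [multilinearCoeff, mul_sum]
    refine tendsto_finsetSum _ fun a _ => ?_
    rw [← mul_assoc]
    exact (tendsto_cubeDiff (g := fun j ε => (1 + ε * l j) * Real.exp (ε * pair m P.lam (u j)))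
      (by simp) (fun j => hasDerivAt_one_add_mul_exp _ _) _ _).const_mul _
  refine h1.congr' ?_
  filter_upwards [Ioc_mem_nhdsGT hε₀] with ε hε
  rw [← cubeDiff_sum]
  congr 1
  funext S
  rw [(integral_prod_mul_density hg (htest ε hε S)).2, genFun_affine hg.wellFormed hv hlam hf,
    mul_sum]
  refine sum_congr rfl fun a _ => ?_
  rw [prod_mul_distrib]
  ring

/-- The integral of the predicted density against a sum over matchings, where the weights `q` of the
matched pairs may be unbounded: they are approximated by their truncations, for which small
multiples stay within the test functions. -/
theorem integral_density_matchingSum {g : Finset T → ℝ} (hg : P.IsDistribution m t g)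
    {v b : T → ℝ} (hv : Measurable v) (hb : Measurable b) (hv0 : ∀ x, 0 ≤ v x)
    (hb0 : ∀ x, 0 ≤ b x) (hvb : ∀ x, v x + b x ≤ 1) {l : J → ℝ} (hl : ∀ j, 0 ≤ l j)
    {q : J → T → ℝ} (hq : ∀ j, Measurable (q j)) (hq0 : ∀ j x, 0 ≤ q j x)
    (hlam : ∀ j, Integrable (fun x => P.lam x * (q j x * b x)) m)
    (hf : ∀ i ∈ Finset.Icc 1 P.n, ∀ a ∈ Finset.Icc 1 (P.h i), P.w i a ≠ 0 → P.r i a ≠ 0 →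
      ∀ j, Integrable (fun x => P.f i a x * (q j x * b x)) m) :
    Integrable (fun y => onAllTuples g y *
        matchingSum (fun i => v (y.2 i)) l fun i j => q j (y.2 i) * b (y.2 i)) (tupleMeasure m) ∧
      ∫ y, onAllTuples g y * matchingSum (fun i => v (y.2 i)) l
        (fun i j => q j (y.2 i) * b (y.2 i)) ∂tupleMeasure m =
          P.multilinearCoeff m v l fun j x => q j x * b x := by
  have hP := hg.wellFormed
  have hmin0 : ∀ (N : ℕ) j x, 0 ≤ min (q j x) (N : ℝ) := fun N j x =>
    le_min (hq0 j x) N.cast_nonneg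
  have hvt : IsTestFunction v := ⟨hv, hv0, fun x => by linarith [hb0 x, hvb x]⟩
  -- with all `q j` cut off at `N`, multiples up to `1 / (#J * N + 1)` add at most `b` to `v`
  have hN : ∀ N : ℕ, _ := fun N => integral_density_matchingSum_of_isTestFunction hg hvt hl
    (u := fun j x => min (q j x) N * b x) (fun j x => mul_nonneg (hmin0 N j x) (hb0 x))
    (fun j => integrable_mul_min hP.lam_measurable hb (hq j) (hq0 j) (hlam j) N)
    (fun i hi a ha hw hr j => integrable_mul_min (hP.f_density i hi a ha hw hr).1 hb (hq j)
      (hq0 j) (hf i hi a ha hw hr j) N)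
    (ε₀ := 1 / (Fintype.card J * N + 1)) (by positivity) (fun ε hε S => by
      refine ⟨?_, fun x => ?_, fun x => ?_⟩
      · exact hv.add ((Finset.measurable_sum _ fun j _ =>
          ((hq j).min measurable_const).mul hb).const_mul ε)
      · exact add_nonneg (hv0 x) (mul_nonneg hε.1.le
          (sum_nonneg fun j _ => mul_nonneg (hmin0 N j x) (hb0 x)))
      · have h1 : ∑ j ∈ S, min (q j x) (N : ℝ) ≤ Fintype.card J * N := by
          refine (sum_le_card_nsmul S _ (N : ℝ) fun j _ => min_le_right _ _).trans ?_
          rw [nsmul_eq_mul]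
          gcongr
          exact card_le_univ S
        have h2 : ε * ∑ j ∈ S, min (q j x) (N : ℝ) ≤ 1 := by
          calc ε * ∑ j ∈ S, min (q j x) (N : ℝ)
              ≤ 1 / (Fintype.card J * N + 1) * (Fintype.card J * N) := by
                exact mul_le_mul hε.2 h1 (sum_nonneg fun j _ => hmin0 N j x) (by positivity)
            _ ≤ 1 := by
                rw [one_div_mul_eq_div, div_le_one (by positivity)]
                linarith
        rw [← sum_mul, ← mul_assoc]
        nlinarith [hvb x, hb0 x])
  refine integral_eq_of_monotone_tendsto (fun N => (hN N).1)
    (fun N y => mul_nonneg (hg.isSetDensity.nonneg _) (matchingSum_nonneg (fun i => hv0 _) hl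
      fun i j => mul_nonneg (hmin0 N j _) (hb0 _)))
    (fun y N N' hNN => mul_le_mul_of_nonneg_left (matchingSum_mono (fun i => hv0 _) hl
      (fun i j => mul_nonneg (hmin0 N j _) (hb0 _)) fun i j => mul_le_mul_of_nonneg_right
        (min_le_min_left _ (Nat.cast_le.2 hNN)) (hb0 _)) (hg.isSetDensity.nonneg _))
    (fun y => tendsto_const_nhds.mul (tendsto_matchingSum (fun _ => tendsto_const_nhds)
      (fun _ => tendsto_const_nhds) fun i j => ?_)) ?_
  · refine tendsto_const_nhds.congr' ?_
    filter_upwards [eventually_ge_atTop ⌈q j (y.2 i)⌉₊] with N hN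
    rw [min_eq_left ((Nat.le_ceil _).trans (Nat.cast_le.2 hN))]
  · simp only [fun N => (hN N).2]
    refine tendsto_const_nhds.mul (tendsto_finsetSum _ fun a ha => ?_)
    by_cases hw : P.weight a = 0
    · simp [hw]
    refine tendsto_const_nhds.mul (tendsto_matchingSum (fun _ => tendsto_const_nhds)
      (fun j => tendsto_const_nhds.add
        (tendsto_pair_min hP.lam_measurable hb (hq j) (hq0 j) (hlam j))) fun i j => ?_)
    by_cases hr : P.r i (a i) = 0
    · simp [hr]
    have hi := mem_hyps_of_mem_globalHyps ha i
    have hwi := w_ne_zero_of_weight_ne_zero hw i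
    exact tendsto_const_nhds.mul (tendsto_pair_min (hP.f_density i i.2 _ hi hwi hr).1 hb (hq j)
      (hq0 j) (hf i i.2 _ hi hwi hr j))

end PMBM

/-! ### Global hypotheses of the update -/

theorem pairwise_disjoint_and_biUnion_iff {I α : Type*} [Fintype I] [DecidableEq α] (M : I → Finset α)
    (A : Finset α) :
    ((∀ i j, i ≠ j → Disjoint (M i) (M j)) ∧ univ.biUnion M = A) ↔
      ∀ q, (∑ i, if q ∈ M i then 1 else 0) = if q ∈ A then 1 else 0 := by
  simp only [← card_filter]
  constructor
  · rintro ⟨hd, rfl⟩ q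
    split_ifs with hq
    · obtain ⟨i, -, hi⟩ := mem_biUnion.1 hq
      refine card_eq_one.2 ⟨i, ?_⟩
      ext j
      simp only [mem_filter, mem_univ, true_and, mem_singleton]
      refine ⟨fun hj => ?_, fun hj => hj ▸ hi⟩
      by_contra hne
      exact disjoint_left.1 (hd j i hne) hj hi
    · refine card_eq_zero.2 (filter_eq_empty_iff.2 fun i _ hi => hq ?_)
      exact mem_biUnion.2 ⟨i, mem_univ i, hi⟩
  · intro h
    constructor
    · intro i j hij
      refine disjoint_left.2 fun q hi hj => ?_
      have h1 : 1 < #{i | q ∈ M i} := one_lt_card.2 ⟨i, by simpa, j, by simpa, hij⟩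
      rw [h q] at h1
      split_ifs at h1 <;> omega
    · ext q
      have h1 := h q
      simp only [mem_biUnion, mem_univ, true_and]
      split_ifs at h1 with hq
      · obtain ⟨i, hi⟩ := card_eq_one.1 h1
        have : i ∈ ({i | q ∈ M i} : Finset I) := hi ▸ mem_singleton_self i
        exact ⟨fun _ => hq, fun _ => ⟨i, (mem_filter.1 this).2⟩⟩
      · refine ⟨fun ⟨i, hi⟩ => ?_, fun h' => (hq h').elim⟩
        exact (filter_eq_empty_iff.1 (card_eq_zero.1 h1) (mem_univ i) hi).elim

/-- A global hypothesis is characterized by the number of its tracks that use a measurement. -/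
theorem PMBM.mem_globalHyps_iff {T : Type*} (P : PMBM T) (a : ↥(Finset.Icc 1 P.n) → ℕ) :
    a ∈ P.globalHyps ↔ (∀ i : ↥(Finset.Icc 1 P.n), a i ∈ Finset.Icc 1 (P.h i)) ∧
      ∀ q, (∑ i : ↥(Finset.Icc 1 P.n), if q ∈ P.meas i (a i) then 1 else 0) =
        if q ∈ P.allMeas then 1 else 0 := by
  rw [PMBM.globalHyps, mem_filter, Fintype.mem_piFinset,
    ← pairwise_disjoint_and_biUnion_iff (fun i : ↥(Finset.Icc 1 P.n) => P.meas i (a i))]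

/-- The number of the hypothesis that updates the hypothesis `a` of a track with `h` hypotheses:
without a detection, or with one of the new measurements. -/
def updatedHyp {m : ℕ} (h a : ℕ) (o : Option (Fin m)) : ℕ :=
  o.elim a fun j => a + h * ((j : ℕ) + 1)

theorem updatedHyp_eq {m : ℕ} (h a : ℕ) (o : Option (Fin m)) :
    updatedHyp h a o = a + h * o.elim 0 fun j => (j : ℕ) + 1 := by
  cases o <;> rfl

theorem updatedHyp_mem {m h a : ℕ} (ha : a ∈ Finset.Icc 1 h) (o : Option (Fin m)) :
    updatedHyp h a o ∈ Finset.Icc 1 (h * (1 + m)) := by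
  rw [mem_Icc] at ha ⊢
  have h1 : (o.elim 0 fun j => (j : ℕ) + 1) ≤ m := by
    cases o with
    | none => exact m.zero_le
    | some j => exact j.2
  rw [updatedHyp_eq, mul_add, mul_one]
  exact ⟨by omega, add_le_add ha.2 (Nat.mul_le_mul_left h h1)⟩

/-- The old hypothesis and the new measurement, if any, from which a hypothesis arises. -/
def originHyp (m h b : ℕ) : ℕ × Option (Fin m) :=
  ((b - 1) % h + 1,
    if hb : 1 ≤ (b - 1) / h ∧ (b - 1) / h ≤ m then some ⟨(b - 1) / h - 1, by omega⟩ else none)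

theorem originHyp_updatedHyp {m h a : ℕ} (ha : a ∈ Finset.Icc 1 h) (o : Option (Fin m)) :
    originHyp m h (updatedHyp h a o) = (a, o) := by
  rw [mem_Icc] at ha
  have h1 : ∀ c, a + h * c - 1 = (a - 1) + h * c := fun c => by omega
  have h2 : ∀ c, (a + h * c - 1) % h = a - 1 := fun c => by
    rw [h1, Nat.add_mul_mod_self_left, Nat.mod_eq_of_lt (by omega)]
  have h3 : ∀ c, (a + h * c - 1) / h = c := fun c => by
    rw [h1, Nat.add_mul_div_left _ _ (by omega), Nat.div_eq_of_lt (by omega), zero_add]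
  rw [updatedHyp_eq]
  unfold originHyp
  simp only [h2, h3]
  refine Prod.ext (by simp only []; omega) ?_
  cases o with
  | none => simp
  | some j => simp

theorem updatedHyp_inj {m h a a' : ℕ} (ha : a ∈ Finset.Icc 1 h) (ha' : a' ∈ Finset.Icc 1 h)
    {o o' : Option (Fin m)} (he : updatedHyp h a o = updatedHyp h a' o') : a = a' ∧ o = o' := by
  rw [← Prod.mk.injEq, ← originHyp_updatedHyp ha, he, originHyp_updatedHyp ha']

theorem exists_updatedHyp {m h b : ℕ} (hb : b ∈ Finset.Icc 1 (h * (1 + m))) :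
    ∃ a ∈ Finset.Icc 1 h, ∃ o : Option (Fin m), b = updatedHyp h a o := by
  rw [mem_Icc] at hb
  have hh : 0 < h := Nat.pos_of_ne_zero fun h0 => by simp [h0] at hb; omega
  have hdiv := Nat.mod_add_div (b - 1) h
  have hlt : (b - 1) / h < 1 + m := (Nat.div_lt_iff_lt_mul hh).2 (by rw [mul_comm]; omega)
  refine ⟨(b - 1) % h + 1, mem_Icc.2 ⟨by omega, Nat.mod_lt _ hh⟩, ?_⟩
  rcases hq : (b - 1) / h with - | c
  · refine ⟨none, ?_⟩
    rw [hq, mul_zero] at hdiv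
    simp only [updatedHyp, Option.elim]
    omega
  · refine ⟨some ⟨c, by omega⟩, ?_⟩
    rw [hq] at hdiv
    simp only [updatedHyp, Option.elim]
    omega

/-- The tracks after the update are the old ones and one for every new measurement. -/
noncomputable def trackEquiv {n m N : ℕ} (hN : N = n + m) :
    ↥(Finset.Icc 1 n) ⊕ Fin m ≃ ↥(Finset.Icc 1 N) :=
  Equiv.ofBijective (Sum.elim (fun i => ⟨i.1, by have := mem_Icc.1 i.2; rw [mem_Icc]; omega⟩)
    fun j => ⟨n + ((j : ℕ) + 1), by have := j.2; rw [mem_Icc]; omega⟩) (by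
    constructor
    · rintro (i | j) (i' | j') h <;> simp only [Sum.elim_inl, Sum.elim_inr, Subtype.mk.injEq] at h
      · exact congrArg _ (Subtype.ext h)
      · have := mem_Icc.1 i.2; omega
      · have := mem_Icc.1 i'.2; omega
      · exact congrArg _ (Fin.ext (by omega))
    · rintro ⟨x, hx⟩
      rw [mem_Icc] at hx
      by_cases h : x ≤ n
      · exact ⟨Sum.inl ⟨x, mem_Icc.2 ⟨hx.1, h⟩⟩, rfl⟩
      · refine ⟨Sum.inr ⟨x - n - 1, by omega⟩, Subtype.ext ?_⟩
        simp only [Sum.elim_inr]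
        omega)

theorem trackEquiv_inl {n m N : ℕ} (hN : N = n + m) (i : ↥(Finset.Icc 1 n)) :
    (trackEquiv hN (Sum.inl i)).1 = i.1 := rfl

theorem trackEquiv_inr {n m N : ℕ} (hN : N = n + m) (j : Fin m) :
    (trackEquiv hN (Sum.inr j)).1 = n + ((j : ℕ) + 1) := rfl

/-- A point that is chosen `n` times is completed by `β` to a point that is chosen exactly once. -/
theorem onceFactor_eq_sum (l : ℝ) (n : ℕ) :
    onceFactor l n = ∑ β : Bool, if n + β.toNat = 1 then (if β then l else 1) else 0 := by
  match n with
  | 0 => simp [onceFactor]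
  | 1 => simp [onceFactor]
  | n + 2 =>
    simp [onceFactor]

/-- A sum over matchings, where it is also recorded by `β` which points of `J` are unmatched. -/
theorem matchingSum_eq_sum_sum {I J : Type*} [Fintype I] [Fintype J] [DecidableEq I]
    [DecidableEq J] (v : I → ℝ) (l : J → ℝ) (u : I → J → ℝ) :
    matchingSum v l u = ∑ θ : I → Option J, ∑ β : J → Bool,
      if ∀ j, #{i | θ i = some j} + (β j).toNat = 1 then
        (∏ i, (θ i).elim (v i) (u i)) * ∏ j, (if β j then l j else 1) else 0 := by
  have h0 : matchingSum v l u = ∑ θ : I → Option J, (∏ i, (θ i).elim (v i) (u i)) *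
      ∏ j, onceFactor (l j) #{i | θ i = some j} := by
    rw [matchingSum]
    congr!
  rw [h0]
  refine sum_congr rfl fun θ _ => ?_
  simp only [onceFactor_eq_sum]
  rw [prod_univ_sum, Fintype.piFinset_univ, mul_sum]
  refine sum_congr rfl fun β _ => ?_
  split_ifs with h
  · rw [prod_congr rfl fun j _ => if_pos (h j)]
  · push Not at h
    obtain ⟨j, hj⟩ := h
    rw [prod_eq_zero (mem_univ j) (if_neg hj), mul_zero]

section Update

variable {X Z : Type*} [MeasurableSpace X] [MeasurableSpace Z] {μ : Measure X} {ν : Measure Z}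
  {S : SensorModel X Z ν} {k m : ℕ} {z : Fin m → Z} {P Q : PMBM (Traj X k)}

/-- The choice of hypotheses of the updated tracks that consists of the old hypotheses `a`, the
assignment `θ` of new measurements to the old tracks, and the new tracks `β` that are in use. -/
noncomputable def updatedChoice (hQ : IsUpdate μ S z P Q) (a : ↥(Finset.Icc 1 P.n) → ℕ)
    (θ : ↥(Finset.Icc 1 P.n) → Option (Fin m)) (β : Fin m → Bool) (x : ↥(Finset.Icc 1 Q.n)) : ℕ :=
  ((trackEquiv hQ.n_eq).symm x).elim
    (fun i : ↥(Finset.Icc 1 P.n) => updatedHyp (P.h i) (a i) (θ i)) fun j => if β j then 2 else 1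

namespace IsUpdate

theorem updatedChoice_inl (hQ : IsUpdate μ S z P Q) (a : ↥(Finset.Icc 1 P.n) → ℕ)
    (θ : ↥(Finset.Icc 1 P.n) → Option (Fin m)) (β : Fin m → Bool) (i : ↥(Finset.Icc 1 P.n)) :
    updatedChoice hQ a θ β (trackEquiv hQ.n_eq (Sum.inl i)) =
      updatedHyp (P.h i) (a i) (θ i) := by
  simp [updatedChoice]

theorem updatedChoice_inr (hQ : IsUpdate μ S z P Q) (a : ↥(Finset.Icc 1 P.n) → ℕ)
    (θ : ↥(Finset.Icc 1 P.n) → Option (Fin m)) (β : Fin m → Bool) (j : Fin m) :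
    updatedChoice hQ a θ β (trackEquiv hQ.n_eq (Sum.inr j)) = if β j then 2 else 1 := by
  simp [updatedChoice]

theorem mem_meas_updatedHyp (hQ : IsUpdate μ S z P Q) {i : ℕ} (hi : i ∈ Finset.Icc 1 P.n) {a : ℕ}
    (ha : a ∈ Finset.Icc 1 (P.h i)) (o : Option (Fin m)) (q : ℕ × ℕ) :
    q ∈ Q.meas i (updatedHyp (P.h i) a o) ↔
      q ∈ P.meas i a ∨ ∃ j : Fin m, o = some j ∧ q = (k, (j : ℕ) + 1) := by
  cases o with
  | none => simp [updatedHyp, hQ.miss_meas i hi a ha]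
  | some j => simp [updatedHyp, hQ.det_meas i hi a ha j, or_comm]

theorem mem_meas_new (hQ : IsUpdate μ S z P Q) (j : Fin m) (b : Bool) (q : ℕ × ℕ) :
    q ∈ Q.meas (P.n + ((j : ℕ) + 1)) (if b then 2 else 1) ↔ b = true ∧ q = (k, (j : ℕ) + 1) := by
  cases b
  · simp [hQ.new_meas_one j]
  · simp [hQ.new_meas_two j]

/-- A choice is a global hypothesis of the update if and only if the old hypotheses form one of the
prediction and every new measurement is used once: by one old track, or by its own new track. -/
theorem updatedChoice_mem_globalHyps_iff (hQ : IsUpdate μ S z P Q) {τ : Measure (Traj X k)}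
    (hP : P.WellFormed τ k) {a : ↥(Finset.Icc 1 P.n) → ℕ}
    (ha : ∀ i : ↥(Finset.Icc 1 P.n), a i ∈ Finset.Icc 1 (P.h i)) (θ : ↥(Finset.Icc 1 P.n) → Option (Fin m))
    (β : Fin m → Bool) :
    updatedChoice hQ a θ β ∈ Q.globalHyps ↔
      a ∈ P.globalHyps ∧ ∀ j, #{i | θ i = some j} + (β j).toNat = 1 := by
  have hmem : ∀ x : ↥(Finset.Icc 1 Q.n), updatedChoice hQ a θ β x ∈ Finset.Icc 1 (Q.h x) := by
    intro x
    obtain ⟨i | j, rfl⟩ := (trackEquiv hQ.n_eq).surjective x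
    · rw [updatedChoice_inl, trackEquiv_inl, hQ.old_h i i.2]
      exact updatedHyp_mem (ha i) _
    · rw [updatedChoice_inr, trackEquiv_inr, hQ.new_h j, mem_Icc]
      split_ifs <;> omega
  -- new measurements are distinguished from the old ones by their time
  have hold : ∀ (i : ↥(Finset.Icc 1 P.n)) (j : Fin m), (k, (j : ℕ) + 1) ∉ P.meas i (a i) := by
    intro i j h
    exact lt_irrefl k (hP.allMeas_lt _ (hP.meas_subset i i.2 _ (ha i) h))
  have hcount : ∀ q : ℕ × ℕ,
      (∑ x : ↥(Finset.Icc 1 Q.n), if q ∈ Q.meas x (updatedChoice hQ a θ β x) then 1 else 0) =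
        (∑ i : ↥(Finset.Icc 1 P.n), if q ∈ P.meas i (a i) ∨
          ∃ j : Fin m, θ i = some j ∧ q = (k, (j : ℕ) + 1) then 1 else 0) +
        ∑ j : Fin m, if β j = true ∧ q = (k, (j : ℕ) + 1) then 1 else 0 := by
    intro q
    rw [← Equiv.sum_comp (trackEquiv hQ.n_eq), Fintype.sum_sum_type]
    congr 1
    · refine sum_congr rfl fun i _ => ?_
      rw [updatedChoice_inl, trackEquiv_inl]
      simp only [hQ.mem_meas_updatedHyp i.2 (ha i)]
    · refine sum_congr rfl fun j _ => ?_
      rw [updatedChoice_inr, trackEquiv_inr]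
      simp only [hQ.mem_meas_new]
  have hnew : ∀ j : Fin m, (∑ x : ↥(Finset.Icc 1 Q.n),
      if (k, (j : ℕ) + 1) ∈ Q.meas x (updatedChoice hQ a θ β x) then 1 else 0) =
        #{i | θ i = some j} + (β j).toNat := by
    intro j
    rw [hcount, card_filter]
    congr 1
    · refine sum_congr rfl fun i _ => ?_
      simp [hold i j, ← Fin.ext_iff]
    · rw [sum_eq_single j]
      · cases β j <;> simp
      · intro j' _ hj'
        simp [← Fin.ext_iff, hj'.symm]
      · simp
  have hsame : ∀ q : ℕ × ℕ, (∀ j : Fin m, q ≠ (k, (j : ℕ) + 1)) → (∑ x : ↥(Finset.Icc 1 Q.n),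
      if q ∈ Q.meas x (updatedChoice hQ a θ β x) then 1 else 0) =
        ∑ i : ↥(Finset.Icc 1 P.n), if q ∈ P.meas i (a i) then 1 else 0 := by
    intro q hq
    rw [hcount]
    simp [hq]
  have hall : ∀ q, q ∈ Q.allMeas ↔ q ∈ P.allMeas ∨ ∃ j : Fin m, q = (k, (j : ℕ) + 1) := by
    intro q
    rw [hQ.allMeas_eq]
    simp [eq_comm]
  rw [PMBM.mem_globalHyps_iff, PMBM.mem_globalHyps_iff]
  simp only [hmem, ha, implies_true, true_and]
  constructor
  · intro h
    refine ⟨fun q => ?_, fun j => ?_⟩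
    · by_cases hq : ∃ j : Fin m, q = (k, (j : ℕ) + 1)
      · obtain ⟨j, rfl⟩ := hq
        rw [if_neg fun h' => lt_irrefl k (hP.allMeas_lt _ h')]
        simp [hold]
      · have h1 := h q
        push Not at hq
        rw [hsame q hq] at h1
        rw [h1]
        simp only [hall, hq, exists_false, or_false]
    · rw [← hnew, h, if_pos ((hall _).2 (Or.inr ⟨j, rfl⟩))]
  · rintro ⟨h1, h2⟩ q
    by_cases hq : ∃ j : Fin m, q = (k, (j : ℕ) + 1)
    · obtain ⟨j, rfl⟩ := hq
      rw [hnew, h2, if_pos ((hall _).2 (Or.inr ⟨j, rfl⟩))]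
    · push Not at hq
      rw [hsame q hq, h1]
      simp only [hall, hq, exists_false, or_false]

/-- A sum of products over the global hypotheses of the update: every global hypothesis of the
prediction is combined with all the matchings of the old tracks with the new measurements. -/
theorem sum_globalHyps (hQ : IsUpdate μ S z P Q) {τ : Measure (Traj X k)}
    (hP : P.WellFormed τ k) {F : ℕ → ℕ → ℝ} {l : Fin m → ℝ}
    (h1 : ∀ j : Fin m, F (P.n + ((j : ℕ) + 1)) 1 = 1)
    (h2 : ∀ j : Fin m, F (P.n + ((j : ℕ) + 1)) 2 = l j) :
    ∑ b ∈ Q.globalHyps, ∏ x : ↥(Finset.Icc 1 Q.n), F x (b x) =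
      ∑ a ∈ P.globalHyps, matchingSum (fun i : ↥(Finset.Icc 1 P.n) => F i (a i)) l
        fun i j => F i (a i + P.h i * ((j : ℕ) + 1)) := by
  have htriple : ∑ a ∈ P.globalHyps, matchingSum (fun i : ↥(Finset.Icc 1 P.n) => F i (a i)) l
        (fun i j => F i (a i + P.h i * ((j : ℕ) + 1))) =
      ∑ p ∈ P.globalHyps ×ˢ ((univ : Finset (↥(Finset.Icc 1 P.n) → Option (Fin m))) ×ˢ
          (univ : Finset (Fin m → Bool))) with
          ∀ j, #{i | p.2.1 i = some j} + (p.2.2 j).toNat = 1,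
        (∏ i, (p.2.1 i).elim (F i (p.1 i)) fun j => F i (p.1 i + P.h i * ((j : ℕ) + 1))) *
          ∏ j, if p.2.2 j then l j else 1 := by
    rw [sum_filter, sum_product]
    refine sum_congr rfl fun a _ => ?_
    rw [sum_product, matchingSum_eq_sum_sum]
    exact sum_congr rfl fun θ _ => sum_congr rfl fun β _ => by congr
  rw [htriple]
  symm
  refine sum_bij (fun p _ => updatedChoice hQ p.1 p.2.1 p.2.2) ?_ ?_ ?_ ?_
  · rintro ⟨a, θ, β⟩ hp
    simp only [mem_filter, mem_product, mem_univ, and_true] at hp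
    exact (hQ.updatedChoice_mem_globalHyps_iff hP (PMBM.mem_hyps_of_mem_globalHyps hp.1) θ β).2 hp
  · rintro ⟨a, θ, β⟩ hp ⟨a', θ', β'⟩ hp' he
    simp only [mem_filter, mem_product, mem_univ, and_true] at hp hp'
    have hl : ∀ i, a i = a' i ∧ θ i = θ' i := by
      intro i
      have h := congrFun he (trackEquiv hQ.n_eq (Sum.inl i))
      simp only [updatedChoice_inl] at h
      exact updatedHyp_inj (PMBM.mem_hyps_of_mem_globalHyps hp.1 i)
        (PMBM.mem_hyps_of_mem_globalHyps hp'.1 i) h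
    have hr : ∀ j, β j = β' j := by
      intro j
      have h := congrFun he (trackEquiv hQ.n_eq (Sum.inr j))
      simp only [updatedChoice_inr] at h
      revert h
      cases β j <;> cases β' j <;> simp
    rw [funext fun i => (hl i).1, funext fun i => (hl i).2, funext hr]
  · intro b hb
    have hbm := PMBM.mem_hyps_of_mem_globalHyps hb
    have hl : ∀ i : ↥(Finset.Icc 1 P.n), ∃ a ∈ Finset.Icc 1 (P.h i), ∃ o : Option (Fin m),
        b (trackEquiv hQ.n_eq (Sum.inl i)) = updatedHyp (P.h i) a o := by
      intro i
      have h := hbm (trackEquiv hQ.n_eq (Sum.inl i))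
      rw [trackEquiv_inl, hQ.old_h i i.2] at h
      exact exists_updatedHyp h
    choose a ha θ hθ using hl
    have hr : ∀ j : Fin m, ∃ β : Bool,
        b (trackEquiv hQ.n_eq (Sum.inr j)) = if β then 2 else 1 := by
      intro j
      have h := hbm (trackEquiv hQ.n_eq (Sum.inr j))
      rw [trackEquiv_inr, hQ.new_h j, mem_Icc] at h
      rcases (show b (trackEquiv hQ.n_eq (Sum.inr j)) = 1 ∨
        b (trackEquiv hQ.n_eq (Sum.inr j)) = 2 by omega) with h' | h'
      · exact ⟨false, h'⟩
      · exact ⟨true, h'⟩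
    choose β hβ using hr
    have hb' : updatedChoice hQ a θ β = b := by
      funext x
      obtain ⟨i | j, rfl⟩ := (trackEquiv hQ.n_eq).surjective x
      · rw [updatedChoice_inl, hθ]
      · rw [updatedChoice_inr, hβ]
    refine ⟨(a, θ, β), ?_, hb'⟩
    simp only [mem_filter, mem_product, mem_univ, and_true]
    exact (hQ.updatedChoice_mem_globalHyps_iff hP ha θ β).1 (hb' ▸ hb)
  · rintro ⟨a, θ, β⟩ -
    rw [← Equiv.prod_comp (trackEquiv hQ.n_eq), Fintype.prod_sum_type]
    congr 1
    · refine prod_congr rfl fun i _ => ?_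
      rw [updatedChoice_inl, trackEquiv_inl]
      dsimp only
      cases θ i <;> rfl
    · refine prod_congr rfl fun j _ => ?_
      rw [updatedChoice_inr, trackEquiv_inr]
      by_cases hb : β j = true <;> simp [hb, h1, h2]

end IsUpdate

end Update

/-! ### The parameters of the update -/

section Pair

variable {T : Type*} [MeasurableSpace T] {m : Measure T}

theorem pair_nonneg {f g : T → ℝ} (hf : ∀ x, 0 ≤ f x) (hg : ∀ x, 0 ≤ g x) : 0 ≤ pair m f g :=
  integral_nonneg fun x => mul_nonneg (hf x) (hg x)

theorem pair_mul_div (f g h : T → ℝ) (c : ℝ) :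
    pair m (fun x => g x * f x / c) h = pair m f (fun x => h x * g x) / c := by
  rw [pair, pair, ← integral_div]
  refine integral_congr_ae (ae_of_all _ fun x => ?_)
  ring

/-- A test function decreases a nonnegative pairing. -/
theorem pair_mul_le {f g h : T → ℝ} (hf : ∀ x, 0 ≤ f x) (hg : ∀ x, 0 ≤ g x)
    (hh : IsTestFunction h) (hi : Integrable (fun x => f x * g x) m) :
    pair m f (fun x => h x * g x) ≤ pair m f g := by
  refine integral_mono_of_nonneg (ae_of_all _ fun x =>
    mul_nonneg (hf x) (mul_nonneg (hh.nonneg x) (hg x))) hi (ae_of_all _ fun x => ?_)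
  exact mul_le_mul_of_nonneg_left (mul_le_of_le_one_left (hg x) (hh.le_one x)) (hf x)

/-- The pairing with a test function vanishes as soon as the pairing without it does. -/
theorem pair_mul_eq_zero {f g h : T → ℝ} (hf : ∀ x, 0 ≤ f x) (hg : ∀ x, 0 ≤ g x)
    (hh : IsTestFunction h) (hi : Integrable (fun x => f x * g x) m) (h0 : pair m f g = 0) :
    pair m f (fun x => h x * g x) = 0 :=
  le_antisymm (h0 ▸ pair_mul_le hf hg hh hi)
    (pair_nonneg hf fun x => mul_nonneg (hh.nonneg x) (hg x))

theorem integrable_and_integral_normalized {f g : T → ℝ} (hi : Integrable (fun x => f x * g x) m)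
    (h0 : pair m f g ≠ 0) : Integrable (fun x => g x * f x / pair m f g) m ∧
      ∫ x, g x * f x / pair m f g ∂m = 1 := by
  simp only [mul_comm (g _)]
  exact ⟨hi.div_const _, by rw [integral_div]; exact div_self h0⟩

end Pair

section Update

variable {X Z : Type*} [MeasurableSpace X] [MeasurableSpace Z] {μ : Measure X} {ν : Measure Z}
  {S : SensorModel X Z ν} {k m : ℕ} {z : Fin m → Z} {P Q : PMBM (Traj X k)}

theorem SensorModel.isTestFunction_trajPD (S : SensorModel X Z ν) :
    IsTestFunction (S.trajPD : Traj X k → ℝ) :=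
  ⟨S.measurable_trajPD, S.trajPD_nonneg, S.trajPD_le_one⟩

theorem SensorModel.isTestFunction_one_sub_trajPD (S : SensorModel X Z ν) :
    IsTestFunction fun x : Traj X k => 1 - S.trajPD x :=
  ⟨measurable_const.sub S.measurable_trajPD, fun x => sub_nonneg.2 (S.trajPD_le_one x),
    fun x => sub_le_self _ (S.trajPD_nonneg x)⟩

theorem SensorModel.detection_nonneg (S : SensorModel X Z ν) (z : Z) (x : Traj X k) :
    0 ≤ S.trajLik z x * S.trajPD x :=
  mul_nonneg (S.trajLik_nonneg z x) (S.trajPD_nonneg x)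

theorem SensorModel.measurable_detection (S : SensorModel X Z ν) (z : Z) :
    Measurable fun x : Traj X k => S.trajLik z x * S.trajPD x :=
  (S.measurable_trajLik z).mul S.measurable_trajPD

/-- The parameters given by the update formulas. -/
noncomputable def updatePMBM (μ : Measure X) (S : SensorModel X Z ν) (z : Fin m → Z)
    (P : PMBM (Traj X k)) : PMBM (Traj X k) where
  lam x := (1 - S.trajPD x) * P.lam x
  n := P.n + m
  h i := if i ≤ P.n then P.h i * (1 + m) else 2
  allMeas := P.allMeas ∪ Finset.univ.image fun j : Fin m => (k, (j : ℕ) + 1)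
  meas i b :=
    let a := (originHyp m (P.h i) b).1
    if i ≤ P.n then (originHyp m (P.h i) b).2.elim (P.meas i a)
      fun j => P.meas i a ∪ {(k, (j : ℕ) + 1)}
    else if b = 2 then {(k, i - P.n)} else ∅
  w i b :=
    let a := (originHyp m (P.h i) b).1
    if i ≤ P.n then (originHyp m (P.h i) b).2.elim
      (P.w i a * (1 - P.r i a * pair (trajMeasure μ k) (P.f i a) S.trajPD))
      fun j => P.w i a * P.r i a *
        pair (trajMeasure μ k) (P.f i a) fun x => S.trajLik (z j) x * S.trajPD x
    else if hb : i - P.n - 1 < m ∧ b = 2 then S.clutter (z ⟨_, hb.1⟩) +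
      pair (trajMeasure μ k) P.lam fun x => S.trajLik (z ⟨_, hb.1⟩) x * S.trajPD x
    else 1
  r i b :=
    let a := (originHyp m (P.h i) b).1
    if i ≤ P.n then (originHyp m (P.h i) b).2.elim
      (P.r i a * pair (trajMeasure μ k) (P.f i a) (fun x => 1 - S.trajPD x) /
        (1 - P.r i a * pair (trajMeasure μ k) (P.f i a) S.trajPD)) fun _ => 1
    else if hb : i - P.n - 1 < m ∧ b = 2 then
      pair (trajMeasure μ k) P.lam (fun x => S.trajLik (z ⟨_, hb.1⟩) x * S.trajPD x) /
        (S.clutter (z ⟨_, hb.1⟩) +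
          pair (trajMeasure μ k) P.lam fun x => S.trajLik (z ⟨_, hb.1⟩) x * S.trajPD x)
    else 0
  f i b x :=
    let a := (originHyp m (P.h i) b).1
    if i ≤ P.n then (originHyp m (P.h i) b).2.elim
      ((1 - S.trajPD x) * P.f i a x /
        pair (trajMeasure μ k) (P.f i a) fun x => 1 - S.trajPD x)
      fun j => S.trajLik (z j) x * S.trajPD x * P.f i a x /
        pair (trajMeasure μ k) (P.f i a) fun x => S.trajLik (z j) x * S.trajPD x
    else if hb : i - P.n - 1 < m ∧ b = 2 then
      S.trajLik (z ⟨_, hb.1⟩) x * S.trajPD x * P.lam x /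
        pair (trajMeasure μ k) P.lam fun x => S.trajLik (z ⟨_, hb.1⟩) x * S.trajPD x
    else 0

theorem isUpdate_updatePMBM (μ : Measure X) (S : SensorModel X Z ν) (z : Fin m → Z)
    (P : PMBM (Traj X k)) : IsUpdate μ S z P (updatePMBM μ S z P) := by
  have hmiss : ∀ {h a : ℕ}, a ∈ Finset.Icc 1 h → originHyp m h a = (a, none) :=
    fun ha => originHyp_updatedHyp ha none
  have hdet : ∀ {h a : ℕ}, a ∈ Finset.Icc 1 h → ∀ j : Fin m,
      originHyp m h (a + h * ((j : ℕ) + 1)) = (a, some j) :=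
    fun ha j => originHyp_updatedHyp ha (some j)
  have hle : ∀ {i : ℕ}, i ∈ Finset.Icc 1 P.n → i ≤ P.n := fun hi => (mem_Icc.1 hi).2
  constructor
  · rfl
  · intro x; rfl
  · rfl
  · intro i hi; simp [updatePMBM, hle hi]
  · intro i hi a ha; simp [updatePMBM, hle hi, hmiss ha]
  · intro i hi a ha; simp [updatePMBM, hle hi, hmiss ha]
  · intro i hi a ha; simp [updatePMBM, hle hi, hmiss ha]
  · intro i hi a ha x; simp [updatePMBM, hle hi, hmiss ha]
  · intro i hi a ha j; simp [updatePMBM, hle hi, hdet ha]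
  · intro i hi a ha j; simp [updatePMBM, hle hi, hdet ha]
  · intro i hi a ha j; simp [updatePMBM, hle hi, hdet ha]
  · intro i hi a ha j x; simp [updatePMBM, hle hi, hdet ha]
  · intro j; simp [updatePMBM]
  · intro j; simp [updatePMBM]
  · intro j; simp [updatePMBM]
  · intro j; simp [updatePMBM]
  · intro j; simp [updatePMBM]
  · intro j; simp [updatePMBM]
  · intro j; simp [updatePMBM]
  · intro j x; simp [updatePMBM]

namespace IsUpdate

/-- The conditions under which the update is considered: an admissible prediction, and finite inner
products in the update formulas. -/
structure Convergent (μ : Measure X) (S : SensorModel X Z ν) (z : Fin m → Z)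
    (P : PMBM (Traj X k)) : Prop where
  wellFormed : P.WellFormed (trajMeasure μ k) k
  lam_integrable : ∀ j, Integrable (fun x => P.lam x * (S.trajLik (z j) x * S.trajPD x))
    (trajMeasure μ k)
  f_integrable : ∀ i ∈ Finset.Icc 1 P.n, ∀ a ∈ Finset.Icc 1 (P.h i), P.w i a ≠ 0 → P.r i a ≠ 0 →
    ∀ j, Integrable (fun x => P.f i a x * (S.trajLik (z j) x * S.trajPD x)) (trajMeasure μ k)

theorem pair_one_sub_trajPD {f : Traj X k → ℝ} (hi : Integrable f (trajMeasure μ k))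
    (h1 : ∫ x, f x ∂trajMeasure μ k = 1) :
    pair (trajMeasure μ k) f (fun x => 1 - S.trajPD x) =
      1 - pair (trajMeasure μ k) f S.trajPD := by
  conv_rhs => rw [← h1]
  rw [pair, pair, ← integral_sub hi (S.isTestFunction_trajPD.integrable_mul hi)]
  refine integral_congr_ae (ae_of_all _ fun x => ?_)
  ring

/-- The generating function of a missed hypothesis, times its weight. -/
theorem w_mul_bernoulli_miss (hQ : IsUpdate μ S z P Q) (hP : Convergent μ S z P)
    {h : Traj X k → ℝ} (hh : IsTestFunction h) {i : ℕ} (hi : i ∈ Finset.Icc 1 P.n) {a : ℕ}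
    (ha : a ∈ Finset.Icc 1 (P.h i)) :
    Q.w i a * (1 - Q.r i a + Q.r i a * pair (trajMeasure μ k) (Q.f i a) h) =
      P.w i a * (1 - P.r i a + P.r i a *
        pair (trajMeasure μ k) (P.f i a) fun x => h x * (1 - S.trajPD x)) := by
  rw [hQ.miss_w i hi a ha, hQ.miss_r i hi a ha, funext (hQ.miss_f i hi a ha)]
  rcases eq_or_ne (P.w i a) 0 with hw | hw
  · simp [hw]
  rcases eq_or_ne (P.r i a) 0 with hr | hr
  · simp [hr]
  obtain ⟨-, hf0, hfi, hf1⟩ := hP.wellFormed.f_density i hi a ha hw hr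
  obtain ⟨hr0, hr1⟩ := hP.wellFormed.r_mem i hi a ha hw
  have hd := S.isTestFunction_one_sub_trajPD (k := k)
  have hp := pair_one_sub_trajPD (S := S) hfi hf1
  have hp0 := pair_nonneg (m := trajMeasure μ k) hf0 hd.nonneg
  rw [pair_mul_div]
  rcases eq_or_ne (pair (trajMeasure μ k) (P.f i a) fun x => 1 - S.trajPD x) 0 with h0 | h0
  · -- the target is detected almost surely, and the missed hypothesis only says that it is absent
    rw [pair_mul_eq_zero hf0 hd.nonneg hh (hd.integrable_mul hfi) h0, h0]
    rw [h0] at hp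
    rw [← sub_eq_zero.1 hp.symm]
    simp
  · set p := pair (trajMeasure μ k) (P.f i a) fun x => 1 - S.trajPD x
    have hD : 1 - P.r i a * pair (trajMeasure μ k) (P.f i a) S.trajPD =
        1 - P.r i a + P.r i a * p := by rw [hp]; ring
    have hpos : 0 < 1 - P.r i a + P.r i a * p :=
      add_pos_of_nonneg_of_pos (sub_nonneg.2 hr1)
        (mul_pos (lt_of_le_of_ne hr0 hr.symm) (lt_of_le_of_ne hp0 h0.symm))
    rw [hD]
    field_simp
    ring

/-- The generating function of a detected hypothesis, times its weight. -/
theorem w_mul_bernoulli_det (hQ : IsUpdate μ S z P Q) (hP : Convergent μ S z P)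
    {h : Traj X k → ℝ} (hh : IsTestFunction h) {i : ℕ} (hi : i ∈ Finset.Icc 1 P.n) {a : ℕ}
    (ha : a ∈ Finset.Icc 1 (P.h i)) (j : Fin m) :
    Q.w i (a + P.h i * ((j : ℕ) + 1)) * (1 - Q.r i (a + P.h i * ((j : ℕ) + 1)) +
      Q.r i (a + P.h i * ((j : ℕ) + 1)) *
        pair (trajMeasure μ k) (Q.f i (a + P.h i * ((j : ℕ) + 1))) h) =
      P.w i a * (P.r i a * pair (trajMeasure μ k) (P.f i a)
        fun x => h x * (S.trajLik (z j) x * S.trajPD x)) := by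
  rw [hQ.det_w i hi a ha, hQ.det_r i hi a ha, funext (hQ.det_f i hi a ha j), pair_mul_div]
  rcases eq_or_ne (P.w i a) 0 with hw | hw
  · simp [hw]
  rcases eq_or_ne (P.r i a) 0 with hr | hr
  · simp [hr]
  obtain ⟨-, hf0, -, -⟩ := hP.wellFormed.f_density i hi a ha hw hr
  rcases eq_or_ne (pair (trajMeasure μ k) (P.f i a) fun x => S.trajLik (z j) x * S.trajPD x) 0
    with h0 | h0
  · rw [pair_mul_eq_zero hf0 (S.detection_nonneg _) hh (hP.f_integrable i hi a ha hw hr j) h0, h0]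
    simp
  · field_simp
    ring

/-- The generating function of the hypothesis that a new measurement starts a track, times its
weight. -/
theorem w_mul_bernoulli_new (hQ : IsUpdate μ S z P Q) (hP : Convergent μ S z P)
    {h : Traj X k → ℝ} (hh : IsTestFunction h) (j : Fin m) :
    Q.w (P.n + ((j : ℕ) + 1)) 2 * (1 - Q.r (P.n + ((j : ℕ) + 1)) 2 +
      Q.r (P.n + ((j : ℕ) + 1)) 2 *
        pair (trajMeasure μ k) (Q.f (P.n + ((j : ℕ) + 1)) 2) h) =
      S.clutter (z j) +
        pair (trajMeasure μ k) P.lam fun x => h x * (S.trajLik (z j) x * S.trajPD x) := by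
  rw [hQ.new_w_two, hQ.new_r_two, funext (hQ.new_f_two j), pair_mul_div]
  have hl := S.clutter_nonneg (z j)
  have hc := pair_nonneg (m := trajMeasure μ k) hP.wellFormed.lam_nonneg
    (S.detection_nonneg (k := k) (z j))
  rcases eq_or_ne (pair (trajMeasure μ k) P.lam fun x => S.trajLik (z j) x * S.trajPD x) 0
    with h0 | h0
  · rw [pair_mul_eq_zero hP.wellFormed.lam_nonneg (S.detection_nonneg _) hh (hP.lam_integrable j)
      h0, h0]
    simp
  · have hpos := add_pos_of_nonneg_of_pos hl (lt_of_le_of_ne hc h0.symm)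
    have := hpos.ne'
    field_simp
    ring

/-- The hypotheses of the update are missed detections, detections, and the two hypotheses of each
new track. -/
theorem forall_hyps (hQ : IsUpdate μ S z P Q) {p : ℕ → ℕ → Prop}
    (h1 : ∀ i ∈ Finset.Icc 1 P.n, ∀ a ∈ Finset.Icc 1 (P.h i), p i a)
    (h2 : ∀ i ∈ Finset.Icc 1 P.n, ∀ a ∈ Finset.Icc 1 (P.h i), ∀ j : Fin m,
      p i (a + P.h i * ((j : ℕ) + 1)))
    (h3 : ∀ j : Fin m, p (P.n + ((j : ℕ) + 1)) 1) (h4 : ∀ j : Fin m, p (P.n + ((j : ℕ) + 1)) 2) :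
    ∀ i ∈ Finset.Icc 1 Q.n, ∀ b ∈ Finset.Icc 1 (Q.h i), p i b := by
  intro i hi b hb
  obtain ⟨i' | j, hij⟩ := (trackEquiv hQ.n_eq).surjective ⟨i, hi⟩
  · have hi' : i = i'.1 := (congrArg Subtype.val hij).symm
    subst hi'
    rw [hQ.old_h _ i'.2] at hb
    obtain ⟨a, ha, o, rfl⟩ := exists_updatedHyp hb
    cases o with
    | none => exact h1 _ i'.2 a ha
    | some j => exact h2 _ i'.2 a ha j
  · have hi' : i = P.n + ((j : ℕ) + 1) := (congrArg Subtype.val hij).symm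
    subst hi'
    rw [hQ.new_h, mem_Icc] at hb
    obtain rfl | rfl : b = 1 ∨ b = 2 := by omega
    exacts [h3 j, h4 j]

/-- The state densities of the update are normalized where they matter: a nonzero weight or
probability of existence excludes a vanishing denominator. -/
theorem f_density (hQ : IsUpdate μ S z P Q) (hP : Convergent μ S z P) :
    ∀ i ∈ Finset.Icc 1 Q.n, ∀ b ∈ Finset.Icc 1 (Q.h i), Q.w i b ≠ 0 → Q.r i b ≠ 0 →
      Measurable (Q.f i b) ∧ (∀ x, 0 ≤ Q.f i b x) ∧ Integrable (Q.f i b) (trajMeasure μ k) ∧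
        ∫ x, Q.f i b x ∂trajMeasure μ k = 1 := by
  have hW := hP.wellFormed
  have hd' := S.isTestFunction_one_sub_trajPD (k := k)
  refine hQ.forall_hyps ?_ ?_ ?_ ?_
  · intro i hi a ha hw' hr'
    rw [hQ.miss_w i hi a ha] at hw'
    have hw := left_ne_zero_of_mul hw'
    rw [hQ.miss_r i hi a ha] at hr'
    have hnum := (div_ne_zero_iff.1 hr').1
    have hr := left_ne_zero_of_mul hnum
    have hp := right_ne_zero_of_mul hnum
    obtain ⟨hfm, hf0, hfi, -⟩ := hW.f_density i hi a ha hw hr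
    rw [funext (hQ.miss_f i hi a ha)]
    exact ⟨(hd'.measurable.mul hfm).div_const _, fun x => div_nonneg
      (mul_nonneg (hd'.nonneg x) (hf0 x)) (pair_nonneg hf0 hd'.nonneg),
      integrable_and_integral_normalized (hd'.integrable_mul hfi) hp⟩
  · intro i hi a ha j hw' _
    rw [hQ.det_w i hi a ha] at hw'
    have hw := left_ne_zero_of_mul (left_ne_zero_of_mul hw')
    have hr := right_ne_zero_of_mul (left_ne_zero_of_mul hw')
    have hp := right_ne_zero_of_mul hw'
    obtain ⟨hfm, hf0, -, -⟩ := hW.f_density i hi a ha hw hr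
    rw [funext (hQ.det_f i hi a ha j)]
    exact ⟨((S.measurable_detection (z j)).mul hfm).div_const _, fun x => div_nonneg
      (mul_nonneg (S.detection_nonneg _ x) (hf0 x)) (pair_nonneg hf0 (S.detection_nonneg _)),
      integrable_and_integral_normalized (hP.f_integrable i hi a ha hw hr j) hp⟩
  · intro j _ hr'
    exact (hr' (hQ.new_r_one j)).elim
  · intro j _ hr'
    rw [hQ.new_r_two] at hr'
    have hp := (div_ne_zero_iff.1 hr').1
    rw [funext (hQ.new_f_two j)]
    exact ⟨((S.measurable_detection (z j)).mul hW.lam_measurable).div_const _, fun x => div_nonneg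
      (mul_nonneg (S.detection_nonneg _ x) (hW.lam_nonneg x))
      (pair_nonneg hW.lam_nonneg (S.detection_nonneg _)),
      integrable_and_integral_normalized (hP.lam_integrable j) hp⟩

/-- The parameters of the update are admissible as soon as the total weight is positive. -/
theorem wellFormed (hQ : IsUpdate μ S z P Q) (hP : Convergent μ S z P)
    (hpos : 0 < ∑ b ∈ Q.globalHyps, Q.rawWeight b) :
    Q.WellFormed (trajMeasure μ k) (k + 1) := by
  have hW := hP.wellFormed
  have hd' := S.isTestFunction_one_sub_trajPD (k := k)
  have hle : ∀ i ∈ Finset.Icc 1 P.n, ∀ a ∈ Finset.Icc 1 (P.h i), P.w i a ≠ 0 → P.r i a ≠ 0 →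
      0 ≤ pair (trajMeasure μ k) (P.f i a) (fun x => 1 - S.trajPD x) ∧
      P.r i a * pair (trajMeasure μ k) (P.f i a) (fun x => 1 - S.trajPD x) ≤
        1 - P.r i a * pair (trajMeasure μ k) (P.f i a) S.trajPD := by
    intro i hi a ha hw hr
    obtain ⟨-, hf0, hfi, hf1⟩ := hW.f_density i hi a ha hw hr
    refine ⟨pair_nonneg hf0 hd'.nonneg, ?_⟩
    rw [pair_one_sub_trajPD hfi hf1]
    linarith [(hW.r_mem i hi a ha hw).2]
  have hsubset : ∀ i ∈ Finset.Icc 1 P.n, ∀ a ∈ Finset.Icc 1 (P.h i),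
      P.meas i a ⊆ Q.allMeas := fun i hi a ha => by
    rw [hQ.allMeas_eq]
    exact (hW.meas_subset i hi a ha).trans subset_union_left
  have hnewmem : ∀ j : Fin m, {(k, (j : ℕ) + 1)} ⊆ Q.allMeas := fun j => by
    rw [hQ.allMeas_eq, singleton_subset_iff]
    exact mem_union_right _ (mem_image_of_mem (fun j : Fin m => (k, (j : ℕ) + 1)) (mem_univ j))
  have hc := fun j : Fin m => pair_nonneg (m := trajMeasure μ k) hW.lam_nonneg
    (S.detection_nonneg (k := k) (z j))
  refine ⟨?_, ?_, ?_, ?_, ?_, ?_, hpos, ?_, hQ.f_density hP⟩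
  · rw [funext hQ.lam_eq]
    exact hd'.measurable.mul hW.lam_measurable
  · intro x
    rw [hQ.lam_eq]
    exact mul_nonneg (hd'.nonneg x) (hW.lam_nonneg x)
  · rw [funext hQ.lam_eq]
    simpa only [mul_comm (P.lam _)] using hd'.integrable_mul hW.lam_integrable
  · intro q hq
    rw [hQ.allMeas_eq, mem_union] at hq
    rcases hq with hq | hq
    · exact (hW.allMeas_lt q hq).trans (Nat.lt_succ_self k)
    · obtain ⟨j, -, rfl⟩ := mem_image.1 hq
      exact Nat.lt_succ_self k
  · refine hQ.forall_hyps ?_ ?_ ?_ ?_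
    · intro i hi a ha
      rw [hQ.miss_meas i hi a ha]
      exact hsubset i hi a ha
    · intro i hi a ha j
      rw [hQ.det_meas i hi a ha]
      exact union_subset (hsubset i hi a ha) (hnewmem j)
    · intro j
      rw [hQ.new_meas_one]
      exact empty_subset _
    · intro j
      rw [hQ.new_meas_two]
      exact hnewmem j
  · refine hQ.forall_hyps ?_ ?_ ?_ ?_
    · intro i hi a ha
      rw [hQ.miss_w i hi a ha]
      rcases eq_or_ne (P.w i a) 0 with hw | hw
      · simp [hw]
      refine mul_nonneg (hW.w_nonneg i hi a ha) ?_
      rcases eq_or_ne (P.r i a) 0 with hr | hr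
      · simp [hr]
      obtain ⟨h1, h2⟩ := hle i hi a ha hw hr
      exact (mul_nonneg (hW.r_mem i hi a ha hw).1 h1).trans h2
    · intro i hi a ha j
      rw [hQ.det_w i hi a ha]
      rcases eq_or_ne (P.w i a) 0 with hw | hw
      · simp [hw]
      rcases eq_or_ne (P.r i a) 0 with hr | hr
      · simp [hr]
      exact mul_nonneg (mul_nonneg (hW.w_nonneg i hi a ha) (hW.r_mem i hi a ha hw).1)
        (pair_nonneg (hW.f_density i hi a ha hw hr).2.1 (S.detection_nonneg _))
    · intro j
      rw [hQ.new_w_one]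
      exact zero_le_one
    · intro j
      rw [hQ.new_w_two]
      exact add_nonneg (S.clutter_nonneg _) (hc j)
  · refine hQ.forall_hyps ?_ ?_ ?_ ?_
    · intro i hi a ha hw'
      rw [hQ.miss_w i hi a ha] at hw'
      have hw := left_ne_zero_of_mul hw'
      rw [hQ.miss_r i hi a ha]
      rcases eq_or_ne (P.r i a) 0 with hr | hr
      · simp [hr]
      obtain ⟨h1, h2⟩ := hle i hi a ha hw hr
      have h3 := mul_nonneg (hW.r_mem i hi a ha hw).1 h1
      exact ⟨div_nonneg h3 (h3.trans h2), div_le_one_of_le₀ h2 (h3.trans h2)⟩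
    · intro i hi a ha j _
      rw [hQ.det_r i hi a ha]
      exact ⟨zero_le_one, le_rfl⟩
    · intro j _
      rw [hQ.new_r_one]
      exact ⟨le_rfl, zero_le_one⟩
    · intro j _
      rw [hQ.new_r_two]
      have hl := S.clutter_nonneg (z j)
      exact ⟨div_nonneg (hc j) (add_nonneg hl (hc j)),
        div_le_one_of_le₀ (le_add_of_nonneg_left hl) (add_nonneg hl (hc j))⟩

end IsUpdate

end Update

/-! ### The posterior -/

section Update

variable {X Z : Type*} [MeasurableSpace X] [MeasurableSpace Z] {μ : Measure X} {ν : Measure Z}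
  {S : SensorModel X Z ν} {k m : ℕ} {z : Fin m → Z} {P Q : PMBM (Traj X k)}

namespace IsUpdate

/-- The coefficient extracted from the generating functional of the prediction is, up to a factor
that does not involve the updated tracks, the mixture of multi-Bernoullis of the update. -/
theorem multilinearCoeff_eq (hQ : IsUpdate μ S z P Q) (hP : Convergent μ S z P)
    {h : Traj X k → ℝ} (hh : IsTestFunction h) :
    P.multilinearCoeff (trajMeasure μ k) (fun x => h x * (1 - S.trajPD x))
      (fun j => S.clutter (z j)) (fun j x => S.trajLik (z j) x * (h x * S.trajPD x)) =
    Real.exp (pair (trajMeasure μ k) P.lam fun x => h x * (1 - S.trajPD x) - 1) *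
      ((∑ b ∈ Q.globalHyps, Q.rawWeight b * ∏ x : ↥(Finset.Icc 1 Q.n), (1 - Q.r x (b x) +
        Q.r x (b x) * pair (trajMeasure μ k) (Q.f x (b x)) h)) /
      ∑ a ∈ P.globalHyps, P.rawWeight a) := by
  have h1 := hQ.sum_globalHyps hP.wellFormed
    (F := fun i b => Q.w i b * (1 - Q.r i b + Q.r i b * pair (trajMeasure μ k) (Q.f i b) h))
    (l := fun j => S.clutter (z j) +
      pair (trajMeasure μ k) P.lam fun x => h x * (S.trajLik (z j) x * S.trajPD x))
    (fun j => by simp [hQ.new_w_one, hQ.new_r_one]) (fun j => hQ.w_mul_bernoulli_new hP hh j)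
  simp only [prod_mul_distrib] at h1
  simp only [PMBM.rawWeight] at h1 ⊢
  rw [h1, PMBM.multilinearCoeff, sum_div]
  congr 1
  refine sum_congr rfl fun a ha => ?_
  have hi := fun i : ↥(Finset.Icc 1 P.n) => PMBM.mem_hyps_of_mem_globalHyps ha i
  simp only [hQ.w_mul_bernoulli_miss hP hh (Subtype.prop _) (hi _),
    hQ.w_mul_bernoulli_det hP hh (Subtype.prop _) (hi _), matchingSum_mul_left,
    mul_left_comm (h _)]
  rw [PMBM.weight, PMBM.rawWeight]
  simp only [mul_left_comm (S.trajLik _ _), PMBM.rawWeight]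
  ring

end IsUpdate

/-- The unnormalized generating functional of the posterior. -/
theorem integral_likelihood_mul_density [StandardBorelSpace X] [SigmaFinite μ]
    [NullSingletonClass μ] [DecidableEq Z] {f : Finset (Traj X k) → ℝ}
    (hf : P.IsDistribution (trajMeasure μ k) k f) (hz : Function.Injective z)
    (hP : IsUpdate.Convergent μ S z P) {h : Traj X k → ℝ} (hh : IsTestFunction h) :
    Integrable (onAllTuples fun A => (∏ x ∈ A, h x) *
        (S.likelihood (Finset.univ.image z) A * f A)) (tupleMeasure (trajMeasure μ k)) ∧
      ∫ y, onAllTuples (fun A => (∏ x ∈ A, h x) *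
        (S.likelihood (Finset.univ.image z) A * f A)) y ∂tupleMeasure (trajMeasure μ k) =
      Real.exp (-∫ z, S.clutter z ∂ν) * P.multilinearCoeff (trajMeasure μ k)
        (fun x => h x * (1 - S.trajPD x)) (fun j => S.clutter (z j))
        (fun j x => S.trajLik (z j) x * (h x * S.trajPD x)) := by
  classical
  have hint : ∀ (g : Traj X k → ℝ) (j : Fin m),
      Integrable (fun x => g x * (S.trajLik (z j) x * S.trajPD x)) (trajMeasure μ k) →
      Integrable (fun x => g x * (S.trajLik (z j) x * (h x * S.trajPD x))) (trajMeasure μ k) := by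
    intro g j hg
    refine (hh.integrable_mul hg).congr (ae_of_all _ fun x => ?_)
    ring
  have hmain := PMBM.integral_density_matchingSum hf
    (v := fun x => h x * (1 - S.trajPD x)) (b := fun x => h x * S.trajPD x)
    (hh.measurable.mul (measurable_const.sub S.measurable_trajPD))
    (hh.measurable.mul S.measurable_trajPD)
    (fun x => mul_nonneg (hh.nonneg x) (sub_nonneg.2 (S.trajPD_le_one x)))
    (fun x => mul_nonneg (hh.nonneg x) (S.trajPD_nonneg x))
    (fun x => by linarith [hh.le_one x])
    (l := fun j => S.clutter (z j)) (fun j => S.clutter_nonneg _)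
    (q := fun j x => S.trajLik (z j) x) (fun j => S.measurable_trajLik (z j))
    (fun j x => S.trajLik_nonneg _ x) (fun j => hint _ j (hP.lam_integrable j))
    (fun i hi a ha hw hr j => hint _ j (hP.f_integrable i hi a ha hw hr j))
  have hae : ∀ᵐ y ∂tupleMeasure (trajMeasure μ k), Real.exp (-∫ z, S.clutter z ∂ν) *
      (onAllTuples f y * matchingSum (fun i => h (y.2 i) * (1 - S.trajPD (y.2 i)))
        (fun j => S.clutter (z j))
        fun i j => S.trajLik (z j) (y.2 i) * (h (y.2 i) * S.trajPD (y.2 i))) =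
      onAllTuples (fun A => (∏ x ∈ A, h x) *
        (S.likelihood (Finset.univ.image z) A * f A)) y := by
    filter_upwards [ae_injective_tupleMeasure (trajMeasure μ k)] with y hy
    rw [onAllTuples_prod_mul _ _ hy]
    simp only [onAllTuples, onTuples]
    rw [S.likelihood_image_image (instTraj := _) hz hy]
    have h1 := matchingSum_mul_left (fun i => h (y.2 i)) (fun i => 1 - S.trajPD (y.2 i))
      (fun j => S.clutter (z j)) fun i j => S.trajPD (y.2 i) * S.trajLik (z j) (y.2 i)
    have h2 : (fun i j => S.trajLik (z j) (y.2 i) * (h (y.2 i) * S.trajPD (y.2 i))) =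
        fun i j => h (y.2 i) * (S.trajPD (y.2 i) * S.trajLik (z j) (y.2 i)) := by
      funext i j
      ring
    rw [h2, h1]
    ring
  refine ⟨(hmain.1.const_mul _).congr hae, ?_⟩
  rw [← integral_congr_ae hae, integral_const_mul, hmain.2]

/-- The posterior is a PMBM with the parameters of the update. -/
theorem IsUpdate.isDistribution_posterior [StandardBorelSpace X] [SigmaFinite μ]
    [NullSingletonClass μ] [DecidableEq Z] {f : Finset (Traj X k) → ℝ}
    (hf : P.IsDistribution (trajMeasure μ k) k f) (hz : Function.Injective z)
    (hP : IsUpdate.Convergent μ S z P) (hQ : IsUpdate μ S z P Q)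
    (hpos : 0 < setIntegral (trajMeasure μ k)
      fun A => S.likelihood (Finset.univ.image z) A * f A) :
    Q.IsDistribution (trajMeasure μ k) (k + 1) (posterior μ S f (Finset.univ.image z)) := by
  set τ := trajMeasure μ k
  set D := setIntegral τ fun A => S.likelihood (Finset.univ.image z) A * f A with hD
  set W := ∑ a ∈ P.globalHyps, P.rawWeight a
  -- the mixture of multi-Bernoullis of the update, with its unnormalized weights
  set N : (Traj X k → ℝ) → ℝ := fun h => ∑ b ∈ Q.globalHyps, Q.rawWeight b *
    ∏ x : ↥(Finset.Icc 1 Q.n), (1 - Q.r x (b x) + Q.r x (b x) * pair τ (Q.f x (b x)) h) with hN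
  have hval : ∀ h : Traj X k → ℝ, IsTestFunction h →
      Integrable (onAllTuples fun A => (∏ x ∈ A, h x) *
        (S.likelihood (Finset.univ.image z) A * f A)) (tupleMeasure τ) ∧
      ∫ y, onAllTuples (fun A => (∏ x ∈ A, h x) *
        (S.likelihood (Finset.univ.image z) A * f A)) y ∂tupleMeasure τ =
      Real.exp (-∫ z, S.clutter z ∂ν) *
        (Real.exp (pair τ P.lam fun x => h x * (1 - S.trajPD x) - 1) * (N h / W)) := by
    intro h hh
    have h1 := integral_likelihood_mul_density hf hz hP hh
    rw [hQ.multilinearCoeff_eq hP hh] at h1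
    exact h1
  obtain ⟨hi1, hD1⟩ := hval _ isTestFunction_one
  simp only [prod_const_one, one_mul] at hi1 hD1
  rw [← setIntegral_eq hi1, ← hD] at hD1
  have hWpos : 0 < W := hP.wellFormed.total_pos
  have hN1 : 0 < N fun _ => 1 := by
    rw [hD1] at hpos
    have h1 := (mul_pos_iff_of_pos_left (Real.exp_pos _)).1
      ((mul_pos_iff_of_pos_left (Real.exp_pos _)).1 hpos)
    exact (div_pos_iff_of_pos_right hWpos).1 h1
  have hraw : ∑ b ∈ Q.globalHyps, Q.rawWeight b = N fun _ => 1 := by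
    refine sum_congr rfl fun b hb => ?_
    rw [PMBM.rawWeight, ← prod_mul_distrib]
    refine prod_congr rfl fun x _ => ?_
    rcases eq_or_ne (Q.w x (b x)) 0 with hw | hw
    · rw [hw, zero_mul]
    rcases eq_or_ne (Q.r x (b x)) 0 with hr | hr
    · rw [hr, zero_mul, sub_zero, add_zero, mul_one]
    have h1 := (hQ.f_density hP x x.2 _ (PMBM.mem_hyps_of_mem_globalHyps hb x) hw hr).2.2.2
    simp only [pair, mul_one, τ, h1, sub_add_cancel]
  have hwf := hQ.wellFormed hP (hraw ▸ hN1)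
  -- the exponential factors combine to the generating functional of the undetected targets
  have hexp : ∀ h : Traj X k → ℝ, IsTestFunction h →
      Real.exp (pair τ P.lam fun x => h x * (1 - S.trajPD x) - 1) =
        Real.exp (pair τ P.lam fun x => 1 - S.trajPD x - 1) *
          Real.exp (pair τ Q.lam fun x => h x - 1) := by
    intro h hh
    rw [← Real.exp_add]
    congr 1
    have hd := (S.isTestFunction_one_sub_trajPD (k := k)).integrable_mul hf.wellFormed.lam_integrable
    rw [pair, pair, pair, ← integral_add]
    · refine integral_congr_ae (ae_of_all _ fun x => ?_)
      simp only [hQ.lam_eq]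
      ring
    · refine (hd.sub hf.wellFormed.lam_integrable).congr (ae_of_all _ fun x => ?_)
      simp only [Pi.sub_apply]
      ring
    · refine ((hh.integrable_mul hwf.lam_integrable).sub hwf.lam_integrable).congr
        (ae_of_all _ fun x => ?_)
      simp only [Pi.sub_apply]
      ring
  have hpost : ∀ h : Traj X k → ℝ, IsTestFunction h →
      Integrable (onAllTuples fun A => (∏ x ∈ A, h x) *
        posterior μ S f (Finset.univ.image z) A) (tupleMeasure τ) ∧
      ∫ y, onAllTuples (fun A => (∏ x ∈ A, h x) *
        posterior μ S f (Finset.univ.image z) A) y ∂tupleMeasure τ =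
      Real.exp (pair τ Q.lam fun x => h x - 1) * (N h / N fun _ => 1) := by
    intro h hh
    obtain ⟨hi, hI⟩ := hval h hh
    have heq : (onAllTuples fun A => (∏ x ∈ A, h x) *
        posterior μ S f (Finset.univ.image z) A) = fun y => onAllTuples (fun A =>
          (∏ x ∈ A, h x) * (S.likelihood (Finset.univ.image z) A * f A)) y / D := by
      funext y
      simp only [onAllTuples, onTuples, posterior]
      exact (mul_div_assoc _ _ _).symm
    rw [heq]
    refine ⟨hi.div_const D, ?_⟩
    rw [integral_div, hI, hD1, hexp h hh]
    have h1 := (Real.exp_pos (-∫ z, S.clutter z ∂ν)).ne'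
    have h2 := (Real.exp_pos (pair τ P.lam fun x => 1 - S.trajPD x - 1)).ne'
    have h3 := hWpos.ne'
    have h4 := hN1.ne'
    field_simp
  refine ⟨hwf, isSetDensity_iff.2 ⟨fun A => ?_, ?_⟩, fun h hh => ?_⟩
  · exact div_nonneg (mul_nonneg (S.likelihood_nonneg _ _) (hf.isSetDensity.nonneg A)) hpos.le
  · obtain ⟨hi, hI⟩ := hpost _ isTestFunction_one
    simp only [prod_const_one, one_mul] at hi hI
    refine ⟨hi, hI.trans ?_⟩
    rw [div_self hN1.ne']
    simp [pair]
  · obtain ⟨hi, hI⟩ := hpost h hh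
    rw [pgfl, setIntegral_eq hi, hI, PMBM.genFun, hN]
    dsimp only
    rw [sum_div]
    congr 1
    refine sum_congr rfl fun b _ => ?_
    rw [PMBM.weight, hraw]
    ring

end Update

end PMBMUpdate

open Classical in
theorem theorem3 {X Z : Type*} [MeasurableSpace X] [StandardBorelSpace X]
    [MeasurableSpace Z] [StandardBorelSpace Z]
    (μ : Measure X) [SigmaFinite μ] [NullSingletonClass μ] (ν : Measure Z) [SigmaFinite ν] [NullSingletonClass ν]
    (S : SensorModel X Z ν) (k : ℕ) :
    -- the measurement model has the standard point-target generating functional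
    (∀ A : Finset (Traj X k),
      IsSetDensity ν (fun W => S.likelihood W A) ∧
      ∀ g : Z → ℝ, IsTestFunction g →
        pgfl ν (fun W => S.likelihood W A) g =
          Real.exp (pair ν S.clutter fun z => g z - 1) *
            ∏ x ∈ A, (1 - S.trajPD x + S.trajPD x * pair ν (fun z => S.trajLik z x) g)) ∧
    -- the update
    ∀ (P : PMBM (Traj X k)) (f : Finset (Traj X k) → ℝ),
      P.IsDistribution (trajMeasure μ k) k f →
    ∀ (m : ℕ) (z : Fin m → Z), Function.Injective z →
      -- the inner products in the update formulas converge
      (∀ j, Integrable (fun x => P.lam x * (S.trajLik (z j) x * S.trajPD x))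
        (trajMeasure μ k)) →
      (∀ i ∈ Finset.Icc 1 P.n, ∀ a ∈ Finset.Icc 1 (P.h i), P.w i a ≠ 0 → P.r i a ≠ 0 →
        ∀ j, Integrable (fun x => P.f i a x * (S.trajLik (z j) x * S.trajPD x))
          (trajMeasure μ k)) →
      -- the predicted density of the measurement set is positive
      0 < setIntegral (trajMeasure μ k)
        (fun A => S.likelihood (Finset.univ.image z) A * f A) →
      (∃ Q, IsUpdate μ S z P Q) ∧
      ∀ Q, IsUpdate μ S z P Q →
        Q.IsDistribution (trajMeasure μ k) (k + 1)
          (posterior μ S f (Finset.univ.image z)) := by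
  refine ⟨fun A => ⟨S.isSetDensity_likelihood A, fun g hg => S.pgfl_likelihood A hg⟩, ?_⟩
  intro P f hf m z hz hlam hfint hpos
  exact ⟨⟨_, isUpdate_updatePMBM μ S z P⟩, fun Q hQ =>
    hQ.isDistribution_posterior hf hz ⟨hf.wellFormed, hlam, hfint⟩ hpos⟩
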